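/- Let $\mathcal U,\mathcal Y$ be complex Hilbert spaces and let $S$ be a Schur-class function, i.e. an analytic function on the unit disk $\mathbb D$ whose values are contractions in $\mathcal L(\mathcal U,\mathcal Y)$; put $\widetilde S(z)=S(\overline z)^*$. For a Hilbert space $\mathcal E$, $H^2(\mathcal E)$ denotes the $\mathcal E$-valued Hardy space, i.e. the space of $f(z)=\sum_{n\ge0}f_nz^n$ on $\mathbb D$ with $\|f\|^2=\sum\|f_n\|^2<\infty$. Let $\mathcal H(S)$ be the set of $f\in H^2(\mathcal Y)$ with $$\|f\|^2_{\mathcal H(S)}:=\sup_{g\in H^2(\mathcal U)}\bigl\{\|f+Sg\|^2_{H^2(\mathcal Y)}-\|g\|^2_{H^2(\mathcal U)}\bigr\}<\infty .$$ Let $\mathcal D(S)$ be the set of pairs $\begin{bmatrix} f\\ g\end{bmatrix}$ with $f\in H^2(\mathcal Y)$ and $g(z)=\sum_{n\ge 0} a_nz^n\in H^2(\mathcal U)$ for which $z^nf(z)-S(z)(a_0z^{n-1}+\cdots+a_{n-1})\in\mathcal H(S)$ for all $n\ge 0$ and the numbers $$N_n=\bigl\|z^nf(z)-S(z)(a_0z^{n-1}+\cdots+a_{n-1})\bigr\|^2_{\mathcal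 H(S)}+\|a_0\|^2+\cdots+\|a_{n-1}\|^2$$ are uniformly bounded in $n$, normed by $\left\|\begin{bmatrix} f\\ g\end{bmatrix}\right\|^2=\lim_{n\to\infty}N_n$. Write $K_S(z,w)=\dfrac{I-S(z)S(w)^*}{1-z\overline w}$; difference quotients are read as derivatives where their denominator vanishes. Then the following hold. (1) The limit defining the norm exists, and with this norm and pointwise linear operations $\mathcal D(S)$ is a Hilbert space; it is the reproducing kernel Hilbert space with reproducing kernel $$\widehat K_S(z,w)=\begin{bmatrix}K_S(z,w)&\frac{S(z)-S(\overline w)}{z-\overline w}\\[2pt] \frac{\widetilde S(z)-\widetilde S(\overline w)}{z-\overline w}&K_{\widetilde S}(z,w)\end{bmatrix}.$$ (2)&(3) $\mathcal D(S)$ is invariant under $$\widehat R_0:\begin{bmatrix} f(z)\\ g(z)\end{bmatrix}\mapsto\begin{bmatrix}[f(z)-f(0)]/z\\ zg(z)-\widetilde S(z)f(0)\end{bmatrix},$$ which is a bounded operator on $\mathcal D(S)$ with adjoint $$\widehat R_0^{\,*}:\begin{bmatrix} f(z)\\ g(z)\end{bmatrix}\mapsto\begin{bmatrix}zf(z)-S(z)g(0)\\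 [g(z)-g(0)]/z\end{bmatrix},$$ and for all $F=\begin{bmatrix} f\\ g\end{bmatrix}\in\mathcal D(S)$, $$\|\widehat R_0F\|^2=\|F\|^2-\|f(0)\|^2_{\mathcal Y},\qquad \|\widehat R_0^{\,*}F\|^2=\|F\|^2-\|g(0)\|^2_{\mathcal U}.$$ (4) Let $\widehat A_S=\widehat R_0$ on $\mathcal D(S)$, $\widehat B_S:u\mapsto\begin{bmatrix}\frac{S(z)-S(0)}{z}u\\ K_{\widetilde S}(z,0)u\end{bmatrix}$, $\widehat C_S:\begin{bmatrix} f\\ g\end{bmatrix}\mapsto f(0)$ and $\widehat D_S=S(0)$. Then these are bounded operators, the colligation $$\widehat{\mathbf U}_S=\begin{bmatrix}\widehat A_S&\widehat B_S\\ \widehat C_S&\widehat D_S\end{bmatrix}:\mathcal D(S)\oplus\mathcal U\to\mathcal D(S)\oplus\mathcal Y$$ is unitary, and for every $z\in\mathbb D$ the operator $I-z\widehat A_S$ is invertible and $$S(z)=\widehat D_S+z\widehat C_S(I-z\widehat A_S)^{-1}\widehat B_S .$$ (5) A bounded operator $T$ on a Hilbert space $\mathcal X$ is unitarily equivalent to the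 operator $\widehat R_0$ on $\mathcal D(S)$ for some Hilbert spaces $\mathcal U,\mathcal Y$ and some Schur-class function $S$ with values in $\mathcal L(\mathcal U,\mathcal Y)$ if and only if $T$ is a completely non-unitary contraction, i.e. $\|T\|\le1$ and $$\Bigl(\bigcap_{n\ge0}\{x:\|T^{*n}x\|=\|x\|\}\Bigr)\cap\Bigl(\bigcap_{n\ge0}\{x:\|T^nx\|=\|x\|\}\Bigr)=\{0\}.$$ If $\mathcal X$ is separable, then $\mathcal U$ and $\mathcal Y$ can be chosen separable in the "if" direction. -/

import Mathlib

open Filter Topology ContinuousLinearMap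
open scoped ComplexConjugate Complex.UnitDisc

universe u v w

noncomputable section

namespace DBR

section Hardy

variable {E : Type u} [NormedAddCommGroup E] [InnerProductSpace ℂ E]

/-- `f(z) = ∑ aₙ zⁿ` on the open unit disk. -/
def HasTaylor (a : ℕ → E) (f : 𝔻 → E) : Prop :=
  ∀ z : 𝔻, HasSum (fun n : ℕ => (z : ℂ) ^ n • a n) (f z)

open Classical in
/-- The sequence of Taylor coefficients of `f` at the origin (zero if `f` is not
the sum of a power series on the whole disk). -/
def taylorCoeff (f : 𝔻 → E) : ℕ → E :=
  if h : ∃ a : ℕ → E, HasTaylor a f then h.choose else 0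

/-- `f` belongs to the vector-valued Hardy space `H²(E)`: it is analytic on the disk, with
square-summable Taylor coefficients. -/
def MemHardy (f : 𝔻 → E) : Prop :=
  ∃ a : ℕ → E, HasTaylor a f ∧ Summable fun n => ‖a n‖ ^ 2

/-- The squared norm of `H²(E)`. -/
def hardyNormSq (f : 𝔻 → E) : ℝ := ∑' n, ‖taylorCoeff f n‖ ^ 2

/-- The backward shift `f(z) ↦ (f(z) - f(0)) / z`; its value at `z = 0` is `f'(0)`,
the first Taylor coefficient. -/
def backwardShift (f : 𝔻 → E) : 𝔻 → E := fun z =>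
  open Classical in
  if z = 0 then taylorCoeff f 1 else (z : ℂ)⁻¹ • (f z - f 0)

/-- Taylor coefficients are unique. -/
theorem HasTaylor.coeff_unique {a b : ℕ → E} {f : 𝔻 → E} (ha : HasTaylor a f)
    (hb : HasTaylor b f) : a = b := by
  have key : ∀ {c : ℕ → E}, HasTaylor c f →
      HasFPowerSeriesOnBall (fun z : ℂ => if h : ‖z‖ < 1 then f (Complex.UnitDisc.mk z h) else 0)
        (fun n => ContinuousMultilinearMap.mkPiRing ℂ (Fin n) (c n)) 0 1 := by
    intro c hc
    refine ⟨?_, one_pos, ?_⟩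
    · refine ENNReal.le_of_forall_nnreal_lt fun r hr => ?_
      have hr' : (r : ℝ) < 1 := by exact_mod_cast hr
      have hs := (hc (Complex.UnitDisc.mk (r : ℂ) (by simpa using hr'))).summable
      refine FormalMultilinearSeries.le_radius_of_tendsto _ (l := 0) ?_
      have := hs.tendsto_atTop_zero.norm
      simpa [norm_smul, mul_comm] using this
    · intro y hy
      have hy' : ‖y‖ < 1 := by
        simpa [Metric.mem_eball, edist_zero_right, enorm_eq_nnnorm, ← NNReal.coe_lt_coe] using hy
      have := hc (Complex.UnitDisc.mk y hy')
      simpa [hy'] using this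
  have h := (key ha).hasFPowerSeriesAt.eq_formalMultilinearSeries (key hb).hasFPowerSeriesAt
  funext n
  have := congrFun h n
  have := congrArg (fun m => m fun _ => (1 : ℂ)) this
  simpa using this

theorem HasTaylor.taylorCoeff_eq {a : ℕ → E} {f : 𝔻 → E} (h : HasTaylor a f) :
    taylorCoeff f = a := by
  have hex : ∃ a : ℕ → E, HasTaylor a f := ⟨a, h⟩
  rw [taylorCoeff, dif_pos hex]
  exact hex.choose_spec.coeff_unique h

end Hardy

/-- The operator given by the `2 × 2` block matrix `[A, B; C, D]` between Hilbert-space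
direct sums. -/
def blockOp {E F E' F' : Type*}
    [NormedAddCommGroup E] [InnerProductSpace ℂ E] [NormedAddCommGroup F] [InnerProductSpace ℂ F]
    [NormedAddCommGroup E'] [InnerProductSpace ℂ E'] [NormedAddCommGroup F']
    [InnerProductSpace ℂ F']
    (A : E →L[ℂ] E') (B : F →L[ℂ] E') (C : E →L[ℂ] F') (D : F →L[ℂ] F') :
    WithLp 2 (E × F) →L[ℂ] WithLp 2 (E' × F') :=
  (WithLp.prodContinuousLinearEquiv 2 ℂ E' F').symm.toContinuousLinearMap ∘L
    ((A.coprod B).prod (C.coprod D)) ∘L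
      (WithLp.prodContinuousLinearEquiv 2 ℂ E F).toContinuousLinearMap

/-- A bounded operator between two Hilbert spaces is unitary. -/
def IsUnitaryOp {E F : Type*} [NormedAddCommGroup E] [InnerProductSpace ℂ E] [CompleteSpace E]
    [NormedAddCommGroup F] [InnerProductSpace ℂ F] [CompleteSpace F] (V : E →L[ℂ] F) : Prop :=
  adjoint V ∘L V = ContinuousLinearMap.id ℂ E ∧ V ∘L adjoint V = ContinuousLinearMap.id ℂ F

/-- Completely non-unitary contractions. -/
def IsCNUContraction {X : Type*} [NormedAddCommGroup X] [InnerProductSpace ℂ X] [CompleteSpace X]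
    (T : X →L[ℂ] X) : Prop :=
  ‖T‖ ≤ 1 ∧
    (⋂ n : ℕ, {x : X | ‖(adjoint T ^ n) x‖ = ‖x‖}) ∩ (⋂ n : ℕ, {x : X | ‖(T ^ n) x‖ = ‖x‖}) = {0}

section Space

variable {U : Type u} [NormedAddCommGroup U] [InnerProductSpace ℂ U]
  {Y : Type v} [NormedAddCommGroup Y] [InnerProductSpace ℂ Y]

/-- The Schur class: analytic on the open unit disk, with contractive values.
Only the values of `S` on the open disk matter. -/
def IsSchur (S : ℂ → U →L[ℂ] Y) : Prop :=
  DifferentiableOn ℂ S (Metric.ball 0 1) ∧ ∀ z ∈ Metric.ball (0 : ℂ) 1, ‖S z‖ ≤ 1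

/-- The numbers `‖f + S g‖² - ‖g‖²`, for `g ∈ H²(U)`, with norms taken in `H²(Y)` and `H²(U)`. -/
def hsValues (S : ℂ → U →L[ℂ] Y) (f : 𝔻 → Y) : Set ℝ :=
  {r | ∃ g : 𝔻 → U, MemHardy g ∧
    r = hardyNormSq (fun z => f z + S z (g z)) - hardyNormSq g}

/-- Membership in the one-component space `H(S)`. -/
def MemH (S : ℂ → U →L[ℂ] Y) (f : 𝔻 → Y) : Prop :=
  MemHardy f ∧ BddAbove (hsValues S f)

/-- The squared norm of `H(S)`. -/
def hNormSq (S : ℂ → U →L[ℂ] Y) (f : 𝔻 → Y) : ℝ := sSup (hsValues S f)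

/-- The function `zⁿ f(z) - S(z) (a₀ zⁿ⁻¹ + ⋯ + aₙ₋₁)`. -/
def shifted (S : ℂ → U →L[ℂ] Y) (f : 𝔻 → Y) (a : ℕ → U) (n : ℕ) : 𝔻 → Y := fun z =>
  (z : ℂ) ^ n • f z - S z (∑ k ∈ Finset.range n, (z : ℂ) ^ (n - 1 - k) • a k)

/-- The numbers `Nₙ` attached to a pair `(f, g)`. -/
def dSeq (S : ℂ → U →L[ℂ] Y) (f : 𝔻 → Y) (g : 𝔻 → U) (n : ℕ) : ℝ :=
  hNormSq S (shifted S f (taylorCoeff g) n) + ∑ k ∈ Finset.range n, ‖taylorCoeff g k‖ ^ 2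

/-- Membership of the pair `F = (f, g)` in `D(S)`: `f ∈ H²(Y)`, `g ∈ H²(U)`, and the numbers `Nₙ`
are finite and uniformly bounded. -/
def MemD (S : ℂ → U →L[ℂ] Y) (F : 𝔻 → WithLp 2 (Y × U)) : Prop :=
  MemHardy (fun z => (F z).fst) ∧ MemHardy (fun z => (F z).snd) ∧
    (∀ n, MemH S (shifted S (fun z => (F z).fst) (taylorCoeff fun z => (F z).snd) n)) ∧
    BddAbove (Set.range (dSeq S (fun z => (F z).fst) fun z => (F z).snd))

/-- The set `D(S)` of pairs of functions. -/
@[ext] structure DSpace (S : ℂ → U →L[ℂ] Y) where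
  toFun : 𝔻 → WithLp 2 (Y × U)
  mem : MemD S toFun

/-- The Hilbert space structure in force on the set `D(S)` is the one of the space `D(S)`:
its elements are identified with the pairs of functions that they are (so that the linear
operations are pointwise and evaluations are continuous), and the squared norm is `lim Nₙ`.
These requirements determine the structure. -/
structure IsDStructure (S : ℂ → U →L[ℂ] Y) [NormedAddCommGroup (DSpace S)]
    [InnerProductSpace ℂ (DSpace S)] [RKHS ℂ (DSpace S) 𝔻 (WithLp 2 (Y × U))] : Prop where
  coe_eq : ∀ F : DSpace S, RKHS.coeCLM ℂ F = F.toFun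
  tendsto_norm_sq : ∀ F : DSpace S,
    Tendsto (dSeq S (fun z => (F.toFun z).fst) fun z => (F.toFun z).snd) atTop (𝓝 (‖F‖ ^ 2))

variable [CompleteSpace U] [CompleteSpace Y]

/-- `S̃(z) = S(z̄)*`. -/
def tilde (S : ℂ → U →L[ℂ] Y) : ℂ → Y →L[ℂ] U := fun z => adjoint (S (conj z))

/-- The kernel `K_S(z, w) = (I - S(z) S(w)*) / (1 - z w̄)`. -/
def kS (S : ℂ → U →L[ℂ] Y) (z w : ℂ) : Y →L[ℂ] Y :=
  (1 - z * conj w)⁻¹ • (ContinuousLinearMap.id ℂ Y - S z ∘L adjoint (S w))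

/-- The `2 × 2` block kernel. Here `dslope S w̄ z = (S(z) - S(w̄)) / (z - w̄)`, to be read as
`S'(z)` when `z = w̄`. -/
def kHat (S : ℂ → U →L[ℂ] Y) :
    Matrix 𝔻 𝔻 (WithLp 2 (Y × U) →L[ℂ] WithLp 2 (Y × U)) :=
  Matrix.of fun z w => blockOp
    (kS S z w) (dslope S (conj (w : ℂ)) z)
    (dslope (tilde S) (conj (w : ℂ)) z) (kS (tilde S) z w)

/-- `(f, g) ↦ ((f(z) - f(0)) / z, z g(z) - S̃(z) f(0))`. -/
def hatR (S : ℂ → U →L[ℂ] Y) (F : 𝔻 → WithLp 2 (Y × U)) : 𝔻 → WithLp 2 (Y × U) := fun z =>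
  WithLp.toLp 2 (backwardShift (fun x => (F x).fst) z,
    (z : ℂ) • (F z).snd - tilde S z (F 0).fst)

/-- `(f, g) ↦ (z f(z) - S(z) g(0), (g(z) - g(0)) / z)`. -/
def hatRAdj (S : ℂ → U →L[ℂ] Y) (F : 𝔻 → WithLp 2 (Y × U)) : 𝔻 → WithLp 2 (Y × U) := fun z =>
  WithLp.toLp 2 ((z : ℂ) • (F z).fst - S z (F 0).snd,
    backwardShift (fun x => (F x).snd) z)

/-- `u ↦ ((S(z) - S(0)) u / z, K_{S̃}(z, 0) u)`. -/
def hatB (S : ℂ → U →L[ℂ] Y) (x : U) : 𝔻 → WithLp 2 (Y × U) := fun z =>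
  WithLp.toLp 2 (dslope S 0 z x, kS (tilde S) z 0 x)

/-- `T` is unitarily equivalent to the operator `R̂₀` on the Hilbert space `D(S)`. -/
def IsModelledBy {X : Type*} [NormedAddCommGroup X] [InnerProductSpace ℂ X]
    (T : X →L[ℂ] X) (S : ℂ → U →L[ℂ] Y) : Prop :=
  ∃ (_ : NormedAddCommGroup (DSpace S)) (_ : InnerProductSpace ℂ (DSpace S))
    (_ : CompleteSpace (DSpace S)) (_ : RKHS ℂ (DSpace S) 𝔻 (WithLp 2 (Y × U))),
    IsDStructure S ∧
    ∃ R : DSpace S →L[ℂ] DSpace S, (∀ F, (R F).toFun = hatR S F.toFun) ∧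
      ∃ W : X ≃ₗᵢ[ℂ] DSpace S, ∀ x, W (T x) = R (W x)

end Space

end DBR

end

/-! The space `D(S)` is a space of two-sided sequences in disguise. A pair `(f, g)` with Taylor
coefficients `fₙ`, `aₙ` is read as a sequence of pairs indexed by `ℤ`, with `(fₙ, 0)` at the index
`n ≥ 0` and `(0, aₙ)` at the index `-1 - n` (`pairSeq`). The coefficients of `S` define on `ℤ` the
translation-invariant kernel `laurentKernel`, whose blocks are built from the identity and the
coefficients of `S` and of its adjoint. It is positive semidefinite because the lower triangular
Toeplitz matrices of a Schur function are contractions (`IsSchur.isToeplitzContraction`, obtained by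
sampling polynomials at roots of unity; `posSemidef_laurentKernel`), so it has a reproducing kernel
Hilbert space `H`.

The squared norm of `x : H` is the supremum of `2 Re ⟪x, v⟫ - ‖v‖²` over the finite combinations `v`
of kernel functions. When `x` comes from the pair `(f, g)`, the supremum over the combinations
supported on the indices `≥ -n` is, after completing the square, the number `Nₙ`
(`IsSchur.testValue_le_of_memH`, `IsSchur.memH_of_testValue_le`). Hence `Nₙ` tends to `‖x‖²`
(`IsSchur.tendsto_dSeq`), boundedness of the `Nₙ` is membership in `H` (`IsSchur.memD_iff`), and
`D(S)` is the closed subspace `modelSubmodule H` of the sequences with first components supported on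
`n ≥ 0` and second components supported on `n < 0` (`bijective_toDSpace`).

The bilateral shift is unitary on `H` by translation invariance (`exists_bilateralShift`). Followed
by the projection that removes the coefficient leaving its half-line, it gives a unitary colligation
`[A, B; C, S(0)]` on the model subspace in which `A` acts as `R̂₀` (`exists_modelOperators`). The
norm identities, the adjoint of `R̂₀` and the transfer function formula are read off from it
(`IsSchur.exists_canonicalModel`), and so is the kernel of `D(S)`: for every unitary colligation
with transfer function `S`, the evaluations `x ↦ (C (1 - zA)⁻¹ x, B* (1 - zA*)⁻¹ x)` have the Gram
kernel `K̂_S` (`IsUnitaryRealization.stateEval_comp_adjoint`).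

The evaluations of a unitary colligation all vanish on `x` exactly when `A` and `A*` are isometric
along the whole orbit of `x` (`IsUnitaryRealization.norm_pow_eq_iff_stateEval`). So `R̂₀` is
completely non-unitary; and if a contraction `T` is completely non-unitary, then the states of its
Halmos colligation `[T, (1 - TT*)^(1/2); (1 - T*T)^(1/2), -T*]` are separated by evaluations whose
Gram kernel is that of `D(S)`, which makes `T` unitarily equivalent to `R̂₀` on `D(S)`
(`IsUnitaryRealization.isModelledBy`). -/

noncomputable section

namespace DBR

/-! ### Power series on the disk -/

section Normed

variable {E : Type*} [NormedAddCommGroup E] [NormedSpace ℂ E]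

/-- A power series that converges on the open unit disk converges absolutely there. -/
lemma summable_pow_mul_norm {a : ℕ → E} (h : ∀ z : 𝔻, Summable fun n => (z : ℂ) ^ n • a n)
    {r : ℝ} (hr0 : 0 ≤ r) (hr : r < 1) : Summable fun n => r ^ n * ‖a n‖ := by
  obtain ⟨R, hrR, hR1⟩ := exists_between hr
  have hR0 : 0 < R := hr0.trans_lt hrR
  have hs := h (Complex.UnitDisc.mk (R : ℂ) (by
    rw [Complex.norm_real, Real.norm_of_nonneg hR0.le]; exact hR1))
  have ht := hs.tendsto_atTop_zero.norm
  obtain ⟨K, hK⟩ : ∃ K, ∀ n, R ^ n * ‖a n‖ ≤ K := by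
    obtain ⟨K, hK⟩ := ht.bddAbove_range
    refine ⟨K, fun n => ?_⟩
    have := hK ⟨n, rfl⟩
    simpa [norm_smul, abs_of_pos hR0] using this
  refine Summable.of_nonneg_of_le (fun n => by positivity) (fun n => ?_)
    ((summable_geometric_of_lt_one (by positivity : 0 ≤ r / R)
      ((div_lt_one hR0).2 hrR)).mul_right K)
  calc r ^ n * ‖a n‖ = (r / R) ^ n * (R ^ n * ‖a n‖) := by
        rw [div_pow]; field_simp
    _ ≤ (r / R) ^ n * K := by gcongr; exact hK n

end Normed

section Hardy

variable {E : Type*} [NormedAddCommGroup E] [InnerProductSpace ℂ E]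

lemma HasTaylor.summable_norm_apply {a : ℕ → E} {f : 𝔻 → E} (h : HasTaylor a f) (z : 𝔻) :
    Summable fun n => ‖(z : ℂ) ^ n • a n‖ := by
  simpa [norm_smul] using
    summable_pow_mul_norm (fun z => (h z).summable) (norm_nonneg (z : ℂ)) z.norm_lt_one

lemma HasTaylor.add {a b : ℕ → E} {f g : 𝔻 → E} (ha : HasTaylor a f) (hb : HasTaylor b g) :
    HasTaylor (a + b) (f + g) := fun z => by
  simpa [smul_add] using (ha z).add (hb z)

lemma HasTaylor.sub {a b : ℕ → E} {f g : 𝔻 → E} (ha : HasTaylor a f) (hb : HasTaylor b g) :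
    HasTaylor (a - b) (f - g) := fun z => by
  simpa [smul_sub] using (ha z).sub (hb z)

lemma HasTaylor.apply_zero {a : ℕ → E} {f : 𝔻 → E} (ha : HasTaylor a f) : f 0 = a 0 := by
  have h0 := ha 0
  have h1 : HasSum (fun n : ℕ => ((0 : 𝔻) : ℂ) ^ n • a n) (a 0) := by
    have := hasSum_single (f := fun n : ℕ => ((0 : 𝔻) : ℂ) ^ n • a n) 0
      (fun n hn => by simp [hn])
    simpa using this
  exact h0.unique h1

/-- Multiplication by `z ^ n` inserts `n` zero coefficients. -/
lemma HasTaylor.pow_smul {a : ℕ → E} {f : 𝔻 → E} (ha : HasTaylor a f) (n : ℕ) :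
    HasTaylor (fun j => if n ≤ j then a (j - n) else 0) (fun z => (z : ℂ) ^ n • f z) := fun z => by
  have h1 : HasSum (fun j => (z : ℂ) ^ (j + n) • a j) ((z : ℂ) ^ n • f z) := by
    have := (ha z).const_smul ((z : ℂ) ^ n)
    simpa [smul_smul, pow_add, mul_comm] using this
  have hinj : Function.Injective fun j : ℕ => j + n := add_left_injective n
  refine (hinj.hasSum_iff (f := fun j : ℕ =>
    (z : ℂ) ^ j • (if n ≤ j then a (j - n) else 0)) ?_).1 (by simpa [Function.comp_def] using h1)
  intro j hj
  have : ¬ n ≤ j := fun h => hj ⟨j - n, by simp [h]⟩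
  simp [this]

/-- The polynomial with coefficients `a 0, …, a (n - 1)`. -/
lemma hasTaylor_sum_range (a : ℕ → E) (n : ℕ) :
    HasTaylor (fun j => if j < n then a j else 0)
      (fun z => ∑ j ∈ Finset.range n, (z : ℂ) ^ j • a j) := fun z => by
  have := hasSum_sum_of_ne_finset_zero (L := .unconditional _) (s := Finset.range n)
    (f := fun j : ℕ => (z : ℂ) ^ j • (if j < n then a j else 0)) (fun j hj => by
      simp [Finset.mem_range.not.1 hj])
  convert this using 1
  exact Finset.sum_congr rfl fun j hj => by simp [Finset.mem_range.1 hj]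

lemma summable_pow_smul_of_bounded [CompleteSpace E] {a : ℕ → E} {K : ℝ} (h : ∀ n, ‖a n‖ ≤ K)
    (z : 𝔻) : Summable fun n => (z : ℂ) ^ n • a n :=
  Summable.of_norm_bounded
    ((summable_geometric_of_lt_one (norm_nonneg _) z.norm_lt_one).mul_right K) fun n => by
      rw [norm_smul, norm_pow]
      gcongr
      exact h n

/-- A bounded sequence is the sequence of coefficients of the power series it defines. -/
lemma hasTaylor_tsum [CompleteSpace E] {a : ℕ → E} {K : ℝ} (h : ∀ n, ‖a n‖ ≤ K) :
    HasTaylor a fun z => ∑' n, (z : ℂ) ^ n • a n :=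
  fun z => (summable_pow_smul_of_bounded h z).hasSum

lemma HasTaylor.memHardy_iff {a : ℕ → E} {f : 𝔻 → E} (h : HasTaylor a f) :
    MemHardy f ↔ Summable fun n => ‖a n‖ ^ 2 := by
  refine ⟨?_, fun hs => ⟨a, h, hs⟩⟩
  rintro ⟨b, hb, hs⟩
  rwa [h.coeff_unique hb]

lemma HasTaylor.hardyNormSq_eq {a : ℕ → E} {f : 𝔻 → E} (h : HasTaylor a f) :
    hardyNormSq f = ∑' n, ‖a n‖ ^ 2 := by
  rw [hardyNormSq, h.taylorCoeff_eq]

lemma MemHardy.hasTaylor {f : 𝔻 → E} (h : MemHardy f) : HasTaylor (taylorCoeff f) f := by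
  obtain ⟨a, ha, -⟩ := h
  rwa [ha.taylorCoeff_eq]

lemma MemHardy.summable {f : 𝔻 → E} (h : MemHardy f) :
    Summable fun n => ‖taylorCoeff f n‖ ^ 2 := h.hasTaylor.memHardy_iff.1 h

lemma HasTaylor.backwardShift {a : ℕ → E} {f : 𝔻 → E} (h : HasTaylor a f) :
    HasTaylor (fun n => a (n + 1)) (backwardShift f) := fun z => by
  by_cases hz : z = 0
  · subst hz
    have := hasSum_single (f := fun n : ℕ => ((0 : 𝔻) : ℂ) ^ n • a (n + 1)) 0
      (fun n hn => by simp [hn])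
    simpa [DBR.backwardShift, h.taylorCoeff_eq] using this
  · have hz' : (z : ℂ) ≠ 0 := by simpa using hz
    have h1 := (hasSum_nat_add_iff' 1).2 (h z)
    have h2 := h1.const_smul (z : ℂ)⁻¹
    simp only [DBR.backwardShift, if_neg hz]
    rw [h.apply_zero]
    convert h2 using 1
    · funext n
      rw [smul_smul, pow_succ', inv_mul_cancel_left₀ hz']
    · simp

end Hardy

section Cauchy

variable {E F : Type*} [NormedAddCommGroup E] [NormedSpace ℂ E]
  [NormedAddCommGroup F] [NormedSpace ℂ F]

/-- Cauchy product of an operator-valued and a vector-valued power series. -/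
lemma hasSum_cauchyProduct [CompleteSpace F] {s : ℕ → E →L[ℂ] F} {b : ℕ → E} {z : ℂ}
    {L : E →L[ℂ] F} {x : E}
    (hs : HasSum (fun n => z ^ n • s n) L) (hb : HasSum (fun n => z ^ n • b n) x)
    (hs' : Summable fun n => ‖z ^ n • s n‖) (hb' : Summable fun n => ‖z ^ n • b n‖) :
    HasSum (fun j => z ^ j • ∑ i ∈ Finset.range (j + 1), s (j - i) (b i)) (L x) := by
  have hsum : Summable fun p : ℕ × ℕ => (z ^ p.1 • s p.1) (z ^ p.2 • b p.2) :=
    Summable.of_norm_bounded (hs'.mul_of_nonneg hb' (fun _ => norm_nonneg _)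
      (fun _ => norm_nonneg _)) fun p => ContinuousLinearMap.le_opNorm _ _
  have h1 : HasSum (fun p : ℕ × ℕ => (z ^ p.1 • s p.1) (z ^ p.2 • b p.2)) (L x) := by
    have h2 := hsum.hasSum.prod_fiberwise (g := fun n => (z ^ n • s n) x)
      fun n => by simpa using (z ^ n • s n).hasSum hb
    have h3 : HasSum (fun n => (z ^ n • s n) x) (L x) := by
      simpa using (ContinuousLinearMap.apply ℂ F x).hasSum hs
    rw [h3.unique h2]
    exact hsum.hasSum
  have h4 := (Finset.HasAntidiagonal.sigmaAntidiagonalEquivProd (A := ℕ)).hasSum_iff.2 h1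
  have h5 := h4.sigma fun n => (hasSum_fintype _)
  convert h5 using 1
  funext j
  have h6 := Finset.sum_attach (Finset.HasAntidiagonal.antidiagonal j)
    (fun p : ℕ × ℕ => (z ^ p.1 • s p.1) (z ^ p.2 • b p.2))
  refine Eq.trans ?_ h6.symm
  rw [← Finset.Nat.sum_antidiagonal_swap, Finset.Nat.sum_antidiagonal_eq_sum_range_succ_mk,
    Finset.smul_sum]
  refine Finset.sum_congr rfl fun i hi => ?_
  have hij : i ≤ j := Nat.lt_succ_iff.1 (Finset.mem_range.1 hi)
  simp only [Prod.fst_swap, Prod.snd_swap, map_smul, smul_apply, smul_smul]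
  rw [← pow_add, Nat.add_sub_cancel' hij]

end Cauchy

/-! ### Schur functions and their lower triangular Toeplitz matrices -/

section Toeplitz

/-- Parseval's identity for a polynomial sampled at the `N`-th roots of unity. -/
lemma sum_norm_sq_rootsOfUnity {E : Type*} [NormedAddCommGroup E] [InnerProductSpace ℂ E]
    {N : ℕ} {ω : ℂ} (hω : IsPrimitiveRoot ω N) (hN : N ≠ 0) (b : ℕ → E) :
    ∑ k ∈ Finset.range N, ‖∑ n ∈ Finset.range N, (ω ^ k) ^ n • b n‖ ^ 2 =
      N * ∑ n ∈ Finset.range N, ‖b n‖ ^ 2 := by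
  have hω1 : ‖ω‖ = 1 := hω.norm'_eq_one hN
  have hcc : conj ω * ω = 1 := by rw [Complex.conj_mul', hω1]; simp
  have horth : ∀ m < N, ∀ n < N, ∑ k ∈ Finset.range N, conj ((ω ^ k) ^ m) * (ω ^ k) ^ n =
      if m = n then (N : ℂ) else 0 := by
    intro m hm n hn
    have hrw : ∀ k, conj ((ω ^ k) ^ m) * (ω ^ k) ^ n = (conj ω ^ m * ω ^ n) ^ k := by
      intro k
      simp only [map_pow, mul_pow, ← pow_mul, mul_comm]
    simp only [hrw]
    split_ifs with h
    · subst h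
      simp [← mul_pow, hcc]
    · set ζ := conj ω ^ m * ω ^ n with hζ
      have hζN : ζ ^ N = 1 := by
        rw [hζ, mul_pow, ← pow_mul, ← pow_mul, mul_comm m, mul_comm n, pow_mul, pow_mul,
          ← map_pow, hω.pow_eq_one]
        simp
      have hζ1 : ζ ≠ 1 := by
        intro h1
        refine h (hω.pow_inj hm hn ?_)
        calc ω ^ m = ω ^ m * ζ := by rw [h1, mul_one]
          _ = (conj ω * ω) ^ m * ω ^ n := by rw [hζ, mul_pow]; ring
          _ = ω ^ n := by rw [hcc, one_pow, one_mul]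
      have := mul_geom_sum ζ N
      rw [hζN, sub_self] at this
      exact (mul_eq_zero.1 this).resolve_left (sub_ne_zero.2 hζ1)
  have key : ((∑ k ∈ Finset.range N, ‖∑ n ∈ Finset.range N, (ω ^ k) ^ n • b n‖ ^ 2 : ℝ) : ℂ) =
      ((N * ∑ n ∈ Finset.range N, ‖b n‖ ^ 2 : ℝ) : ℂ) := by
    push_cast
    calc ∑ k ∈ Finset.range N, (‖∑ n ∈ Finset.range N, (ω ^ k) ^ n • b n‖ : ℂ) ^ 2
        = ∑ k ∈ Finset.range N, ∑ m ∈ Finset.range N, ∑ n ∈ Finset.range N,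
          (conj ((ω ^ k) ^ m) * (ω ^ k) ^ n) * inner ℂ (b m) (b n) := by
          refine Finset.sum_congr rfl fun k _ => ?_
          refine (inner_self_eq_norm_sq_to_K (𝕜 := ℂ)
            (∑ n ∈ Finset.range N, (ω ^ k) ^ n • b n)).symm.trans ?_
          rw [sum_inner]
          refine Finset.sum_congr rfl fun m _ => ?_
          rw [inner_sum]
          refine Finset.sum_congr rfl fun n _ => ?_
          rw [inner_smul_left, inner_smul_right, mul_assoc]
      _ = ∑ m ∈ Finset.range N, ∑ n ∈ Finset.range N,
          (if m = n then (N : ℂ) else 0) * inner ℂ (b m) (b n) := by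
          rw [Finset.sum_comm]
          refine Finset.sum_congr rfl fun m hm => ?_
          rw [Finset.sum_comm]
          refine Finset.sum_congr rfl fun n hn => ?_
          rw [← Finset.sum_mul, horth m (Finset.mem_range.1 hm) n (Finset.mem_range.1 hn)]
      _ = _ := by
          rw [Finset.mul_sum]
          refine Finset.sum_congr rfl fun m hm => ?_
          simp only [ite_mul, zero_mul]
          rw [Finset.sum_ite_eq, if_pos hm, inner_self_eq_norm_sq_to_K]
          rfl
  exact_mod_cast key

variable {U : Type u} [NormedAddCommGroup U] [InnerProductSpace ℂ U]
  {Y : Type v} [NormedAddCommGroup Y] [InnerProductSpace ℂ Y]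

/-- The coefficients of the product of the operator series `∑ sₙ zⁿ` and the vector series
`∑ bₙ zⁿ`. -/
def convCoeff (s : ℕ → U →L[ℂ] Y) (b : ℕ → U) (j : ℕ) : Y :=
  ∑ i ∈ Finset.range (j + 1), s (j - i) (b i)

/-- The finite lower triangular block Toeplitz matrices with entries `s (j - i)` are
contractions. -/
def IsToeplitzContraction (s : ℕ → U →L[ℂ] Y) : Prop :=
  ∀ (N : ℕ) (b : ℕ → U),
    ∑ j ∈ Finset.range N, ‖convCoeff s b j‖ ^ 2 ≤ ∑ j ∈ Finset.range N, ‖b j‖ ^ 2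

/-- The Taylor coefficients of an operator-valued function at the origin. -/
def opCoeff (S : ℂ → U →L[ℂ] Y) (n : ℕ) : U →L[ℂ] Y :=
  (n.factorial : ℂ)⁻¹ • iteratedDeriv n S 0

variable {S : ℂ → U →L[ℂ] Y}

lemma IsSchur.norm_le (hS : IsSchur S) (z : 𝔻) : ‖S z‖ ≤ 1 :=
  hS.2 z (by simpa using z.norm_lt_one)

variable [CompleteSpace Y]

lemma IsSchur.hasSum (hS : IsSchur S) (z : 𝔻) :
    HasSum (fun n => (z : ℂ) ^ n • opCoeff S n) (S z) := by
  have := Complex.hasSum_taylorSeries_on_ball (r := 1) (c := (0 : ℂ)) (f := S) (z := (z : ℂ))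
    (by simpa using hS.1) (by simpa using z.norm_lt_one)
  simpa [opCoeff, smul_smul, mul_comm] using this

lemma IsSchur.hasTaylor_mul (hS : IsSchur S) {b : ℕ → U} {g : 𝔻 → U} (hg : HasTaylor b g) :
    HasTaylor (convCoeff (opCoeff S) b) fun z => S z (g z) := fun z => by
  refine hasSum_cauchyProduct (hS.hasSum z) (hg z) ?_ (hg.summable_norm_apply z)
  simpa [norm_smul] using
    summable_pow_mul_norm (fun z => (hS.hasSum z).summable) (norm_nonneg (z : ℂ)) z.norm_lt_one

/-- On a circle of radius `r < 1` the Taylor polynomials of a Schur function are nearly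
contractive. -/
lemma IsSchur.exists_taylor_norm_le (hS : IsSchur S) {r : ℝ} (hr0 : 0 ≤ r) (hr : r < 1) {ε : ℝ}
    (hε : 0 < ε) (N : ℕ) : ∃ L, N ≤ L ∧ ∀ z : ℂ, ‖z‖ = r →
      ‖∑ l ∈ Finset.range L, z ^ l • opCoeff S l‖ ≤ 1 + ε := by
  have hsum : Summable fun n => r ^ n * ‖opCoeff S n‖ :=
    summable_pow_mul_norm (fun z => (hS.hasSum z).summable) hr0 hr
  have htail := tendsto_sum_nat_add fun n => r ^ n * ‖opCoeff S n‖
  obtain ⟨L, hLN, hL⟩ := ((eventually_ge_atTop N).and (htail.eventually (gt_mem_nhds hε))).exists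
  refine ⟨L, hLN, fun z hz => ?_⟩
  set z' : 𝔻 := Complex.UnitDisc.mk z (hz ▸ hr)
  have h1 := (hasSum_nat_add_iff' L).2 (hS.hasSum z')
  have h2 : ‖S z' - ∑ l ∈ Finset.range L, z ^ l • opCoeff S l‖ ≤
      ∑' n, r ^ (n + L) * ‖opCoeff S (n + L)‖ := by
    refine (congrArg norm h1.tsum_eq).symm.trans_le ?_
    refine tsum_of_norm_bounded ((summable_nat_add_iff L).2 hsum).hasSum fun n => ?_
    rw [norm_smul, norm_pow]
    simp [z', hz]
  calc ‖∑ l ∈ Finset.range L, z ^ l • opCoeff S l‖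
      = ‖S z' - (S z' - ∑ l ∈ Finset.range L, z ^ l • opCoeff S l)‖ := by rw [sub_sub_cancel]
    _ ≤ ‖S z'‖ + ‖S z' - ∑ l ∈ Finset.range L, z ^ l • opCoeff S l‖ := norm_sub_le _ _
    _ ≤ 1 + ε := add_le_add (hS.norm_le z') (h2.trans hL.le)

/-- The Toeplitz matrices of a Schur function are contractions: a Taylor polynomial of `S` times
a polynomial is sampled at the roots of unity of a circle of radius `r < 1`. -/
theorem IsSchur.isToeplitzContraction (hS : IsSchur S) : IsToeplitzContraction (opCoeff S) := by
  intro N b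
  have main : ∀ r : ℝ, 0 < r → r < 1 → ∀ ε : ℝ, 0 < ε →
      ∑ j ∈ Finset.range N, (r ^ j * ‖convCoeff (opCoeff S) b j‖) ^ 2 ≤
        (1 + ε) ^ 2 * ∑ j ∈ Finset.range N, (r ^ j * ‖b j‖) ^ 2 := by
    intro r hr0 hr1 ε hε
    obtain ⟨L, hLN, hL⟩ := hS.exists_taylor_norm_le hr0.le hr1 hε N
    set s' : ℕ → U →L[ℂ] Y := fun l => if l < L then opCoeff S l else 0 with hs'
    set b' : ℕ → U := fun i => if i < N then b i else 0 with hb'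
    set c' : ℕ → Y := convCoeff s' b' with hc'
    -- more sample points than the degree of the product, so that Parseval's identity sees it all
    set M := L + N + 1 with hM
    have hM0 : M ≠ 0 := by omega
    have hs'0 : ∀ l ∉ Finset.range L, s' l = 0 := fun l hl => by
      simp [hs', Finset.mem_range.not.1 hl]
    have hb'0 : ∀ l ∉ Finset.range N, b' l = 0 := fun l hl => by
      simp [hb', Finset.mem_range.not.1 hl]
    have hc'0 : ∀ j ∉ Finset.range M, c' j = 0 := by
      intro j hj
      refine Finset.sum_eq_zero fun i hi => ?_
      rw [Finset.mem_range] at hj hi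
      by_cases hiN : i < N
      · rw [hs'0 _ (by rw [Finset.mem_range]; omega)]; simp
      · rw [hb'0 i (by simpa using hiN)]; simp
    have hc'c : ∀ j < N, c' j = convCoeff (opCoeff S) b j := by
      intro j hj
      refine Finset.sum_congr rfl fun i hi => ?_
      rw [Finset.mem_range] at hi
      simp [hs', hb', show j - i < L by omega, show i < N by omega]
    have hprod : ∀ z : ℂ, (∑ l ∈ Finset.range L, z ^ l • s' l)
        (∑ i ∈ Finset.range N, z ^ i • b' i) = ∑ j ∈ Finset.range M, z ^ j • c' j := by
      intro z
      have e1 := hasSum_sum_of_ne_finset_zero (L := .unconditional _)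
        (s := Finset.range L) (f := fun l => z ^ l • s' l) fun l hl => by rw [hs'0 l hl, smul_zero]
      have e2 := hasSum_sum_of_ne_finset_zero (L := .unconditional _)
        (s := Finset.range N) (f := fun l => z ^ l • b' l) fun l hl => by rw [hb'0 l hl, smul_zero]
      have e3 := hasSum_sum_of_ne_finset_zero (L := .unconditional _)
        (s := Finset.range M) (f := fun l => z ^ l • c' l) fun l hl => by rw [hc'0 l hl, smul_zero]
      refine (hasSum_cauchyProduct e1 e2 ?_ ?_).unique e3
      · exact summable_of_ne_finset_zero (L := .unconditional _) (s := Finset.range L)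
          fun l hl => by
            rw [hs'0 l hl, smul_zero, norm_zero]
      · exact summable_of_ne_finset_zero (L := .unconditional _) (s := Finset.range N)
          fun l hl => by
            rw [hb'0 l hl, smul_zero, norm_zero]
    set ω := Complex.exp (2 * Real.pi * Complex.I / M) with hωdef
    have hω : IsPrimitiveRoot ω M := Complex.isPrimitiveRoot_exp M hM0
    have hω1 : ‖ω‖ = 1 := hω.norm'_eq_one hM0
    have hPc := sum_norm_sq_rootsOfUnity hω hM0 fun n => (r : ℂ) ^ n • c' n
    have hPb := sum_norm_sq_rootsOfUnity hω hM0 fun n => (r : ℂ) ^ n • b' n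
    have hcomp : ∀ k, ‖∑ n ∈ Finset.range M, (ω ^ k) ^ n • ((r : ℂ) ^ n • c' n)‖ ^ 2 ≤
        (1 + ε) ^ 2 * ‖∑ n ∈ Finset.range M, (ω ^ k) ^ n • ((r : ℂ) ^ n • b' n)‖ ^ 2 := by
      intro k
      set z : ℂ := (r : ℂ) * ω ^ k
      have hz : ‖z‖ = r := by simp [z, hω1, abs_of_pos hr0]
      have e1 : ∑ n ∈ Finset.range M, (ω ^ k) ^ n • ((r : ℂ) ^ n • b' n) =
          ∑ n ∈ Finset.range N, z ^ n • b' n := by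
        have : ∑ n ∈ Finset.range M, (ω ^ k) ^ n • ((r : ℂ) ^ n • b' n) =
            ∑ n ∈ Finset.range M, z ^ n • b' n :=
          Finset.sum_congr rfl fun n _ => by rw [smul_smul, mul_pow, mul_comm]
        rw [this]
        refine (Finset.sum_subset (Finset.range_subset_range.2 (by omega)) fun n _ hn => ?_).symm
        rw [hb'0 n hn, smul_zero]
      have e2 : ∑ n ∈ Finset.range M, (ω ^ k) ^ n • ((r : ℂ) ^ n • c' n) =
          ∑ n ∈ Finset.range M, z ^ n • c' n :=
        Finset.sum_congr rfl fun n _ => by rw [smul_smul, mul_pow, mul_comm]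
      have e3 : ∑ l ∈ Finset.range L, z ^ l • s' l = ∑ l ∈ Finset.range L, z ^ l • opCoeff S l :=
        Finset.sum_congr rfl fun l hl => by simp [hs', Finset.mem_range.1 hl]
      rw [e1, e2, ← hprod z, ← mul_pow]
      refine pow_le_pow_left₀ (norm_nonneg _) ((ContinuousLinearMap.le_opNorm _ _).trans ?_) 2
      rw [e3]
      gcongr
      exact hL z hz
    have hsumk := Finset.sum_le_sum fun k (_ : k ∈ Finset.range M) => hcomp k
    rw [← Finset.mul_sum, hPc, hPb] at hsumk
    have hMpos : (0 : ℝ) < M := by positivity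
    have h3 : ∑ n ∈ Finset.range M, ‖(r : ℂ) ^ n • c' n‖ ^ 2 ≤
        (1 + ε) ^ 2 * ∑ n ∈ Finset.range M, ‖(r : ℂ) ^ n • b' n‖ ^ 2 := by
      refine le_of_mul_le_mul_left ?_ hMpos
      linarith
    have hsub : Finset.range N ⊆ Finset.range M := Finset.range_subset_range.2 (by omega)
    calc ∑ j ∈ Finset.range N, (r ^ j * ‖convCoeff (opCoeff S) b j‖) ^ 2
        = ∑ j ∈ Finset.range N, ‖(r : ℂ) ^ j • c' j‖ ^ 2 := by
          refine Finset.sum_congr rfl fun j hj => ?_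
          rw [hc'c j (Finset.mem_range.1 hj), norm_smul]
          simp [abs_of_pos hr0]
      _ ≤ ∑ j ∈ Finset.range M, ‖(r : ℂ) ^ j • c' j‖ ^ 2 :=
          Finset.sum_le_sum_of_subset_of_nonneg hsub fun _ _ _ => by positivity
      _ ≤ _ := h3
      _ = (1 + ε) ^ 2 * ∑ j ∈ Finset.range N, (r ^ j * ‖b j‖) ^ 2 := by
          congr 1
          rw [← Finset.sum_subset hsub fun n _ hn => by rw [hb'0 n hn]; simp]
          refine Finset.sum_congr rfl fun j hj => ?_
          rw [norm_smul]
          simp [hb', Finset.mem_range.1 hj, abs_of_pos hr0]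
  -- let `r` tend to `1` with `ε = 1 - r`
  have lim1 : Tendsto (fun r : ℝ =>
      ∑ j ∈ Finset.range N, (r ^ j * ‖convCoeff (opCoeff S) b j‖) ^ 2) (𝓝[<] 1)
      (𝓝 (∑ j ∈ Finset.range N, (1 ^ j * ‖convCoeff (opCoeff S) b j‖) ^ 2)) :=
    (Continuous.tendsto (by fun_prop) 1).mono_left nhdsWithin_le_nhds
  have lim2 : Tendsto (fun r : ℝ => (1 + (1 - r)) ^ 2 *
      ∑ j ∈ Finset.range N, (r ^ j * ‖b j‖) ^ 2) (𝓝[<] 1)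
      (𝓝 ((1 + (1 - 1)) ^ 2 * ∑ j ∈ Finset.range N, (1 ^ j * ‖b j‖) ^ 2)) :=
    ((by fun_prop : Continuous fun r : ℝ => (1 + (1 - r)) ^ 2 *
      ∑ j ∈ Finset.range N, (r ^ j * ‖b j‖) ^ 2).tendsto 1).mono_left nhdsWithin_le_nhds
  have hle := le_of_tendsto_of_tendsto lim1 lim2 (by
    filter_upwards [Ioo_mem_nhdsLT (zero_lt_one (α := ℝ))] with r hr
    exact main r hr.1 hr.2 (1 - r) (by linarith [hr.2]))
  simpa using hle

end Toeplitz

/-! ### Reproducing kernel spaces with equal kernels -/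

section Uniqueness

variable {X V H₁ H₂ : Type*} [NormedAddCommGroup V] [InnerProductSpace ℂ V]
  [NormedAddCommGroup H₁] [InnerProductSpace ℂ H₁] [CompleteSpace H₁]
  [NormedAddCommGroup H₂] [InnerProductSpace ℂ H₂] [CompleteSpace H₂]

/-- The linear map `(vₓ)ₓ ↦ ∑ₓ e x vₓ` on finitely supported families. -/
def synthesis (e : X → V →L[ℂ] H₁) : (X →₀ V) →ₗ[ℂ] H₁ :=
  Finsupp.lsum ℂ fun x => (e x).toLinearMap

omit [CompleteSpace H₁] in
lemma synthesis_apply (e : X → V →L[ℂ] H₁) (f : X →₀ V) :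
    synthesis e f = f.sum fun x v => e x v := rfl

lemma denseRange_synthesis {e : X → V →L[ℂ] H₁}
    (he : ∀ y, (∀ x v, inner ℂ (e x v) y = 0) → y = 0) : DenseRange (synthesis e) := by
  have h : (LinearMap.range (synthesis e)).topologicalClosure = ⊤ := by
    rw [Submodule.topologicalClosure_eq_top_iff, Submodule.eq_bot_iff]
    intro y hy
    refine he y fun x v => ?_
    refine (Submodule.mem_orthogonal _ _).1 hy _ ⟨Finsupp.single x v, ?_⟩
    simp [synthesis]
  intro y
  have : y ∈ (LinearMap.range (synthesis e)).topologicalClosure := h ▸ Submodule.mem_top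
  rwa [← SetLike.mem_coe, Submodule.topologicalClosure_coe, LinearMap.coe_range] at this

omit [CompleteSpace H₁] [CompleteSpace H₂] in
lemma norm_synthesis_eq {e₁ : X → V →L[ℂ] H₁} {e₂ : X → V →L[ℂ] H₂}
    (h : ∀ x y v w, inner ℂ (e₁ x v) (e₁ y w) = inner ℂ (e₂ x v) (e₂ y w)) (f : X →₀ V) :
    ‖synthesis e₂ f‖ = ‖synthesis e₁ f‖ := by
  have : inner ℂ (synthesis e₂ f) (synthesis e₂ f) = inner ℂ (synthesis e₁ f) (synthesis e₁ f) := by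
    simp only [synthesis_apply, Finsupp.sum, sum_inner, inner_sum, h]
  rw [@norm_eq_sqrt_re_inner ℂ, @norm_eq_sqrt_re_inner ℂ, this]

/-- Two families of operators with the same Gram kernel, each with dense joint range, are unitarily
equivalent. -/
theorem exists_linearIsometryEquiv_of_gram {e₁ : X → V →L[ℂ] H₁} {e₂ : X → V →L[ℂ] H₂}
    (h₁ : ∀ y, (∀ x v, inner ℂ (e₁ x v) y = 0) → y = 0)
    (h₂ : ∀ y, (∀ x v, inner ℂ (e₂ x v) y = 0) → y = 0)
    (h : ∀ x y v w, inner ℂ (e₁ x v) (e₁ y w) = inner ℂ (e₂ x v) (e₂ y w)) :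
    ∃ T : H₁ ≃ₗᵢ[ℂ] H₂, ∀ x v, T (e₁ x v) = e₂ x v := by
  refine ⟨(LinearEquiv.refl ℂ (X →₀ V)).extendOfIsometry (synthesis e₁) (synthesis e₂)
    (denseRange_synthesis h₁) (denseRange_synthesis h₂) (norm_synthesis_eq h), fun x v => ?_⟩
  have := (LinearEquiv.refl ℂ (X →₀ V)).extendOfIsometry_eq (synthesis e₁) (synthesis e₂)
    (denseRange_synthesis h₁) (denseRange_synthesis h₂) (norm_synthesis_eq h) (Finsupp.single x v)
  simpa [synthesis] using this

end Uniqueness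

/-! ### The Laurent kernel -/

section Kernel

variable {U : Type u} [NormedAddCommGroup U] [InnerProductSpace ℂ U]
  {Y : Type v} [NormedAddCommGroup Y] [InnerProductSpace ℂ Y]

@[simp] lemma blockOp_fst {E F E' F' : Type*}
    [NormedAddCommGroup E] [InnerProductSpace ℂ E] [NormedAddCommGroup F] [InnerProductSpace ℂ F]
    [NormedAddCommGroup E'] [InnerProductSpace ℂ E'] [NormedAddCommGroup F']
    [InnerProductSpace ℂ F'] (A : E →L[ℂ] E') (B : F →L[ℂ] E') (C : E →L[ℂ] F') (D : F →L[ℂ] F')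
    (x : WithLp 2 (E × F)) : (blockOp A B C D x).fst = A x.fst + B x.snd := rfl

@[simp] lemma blockOp_snd {E F E' F' : Type*}
    [NormedAddCommGroup E] [InnerProductSpace ℂ E] [NormedAddCommGroup F] [InnerProductSpace ℂ F]
    [NormedAddCommGroup E'] [InnerProductSpace ℂ E'] [NormedAddCommGroup F']
    [InnerProductSpace ℂ F'] (A : E →L[ℂ] E') (B : F →L[ℂ] E') (C : E →L[ℂ] F') (D : F →L[ℂ] F')
    (x : WithLp 2 (E × F)) : (blockOp A B C D x).snd = C x.fst + D x.snd := rfl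

/-- The coefficients extended by zero to negative indices. -/
def extCoeff (s : ℕ → U →L[ℂ] Y) (k : ℤ) : U →L[ℂ] Y := if 0 ≤ k then s k.toNat else 0

lemma extCoeff_of_neg (s : ℕ → U →L[ℂ] Y) {k : ℤ} (h : k < 0) : extCoeff s k = 0 :=
  if_neg (by omega)

@[simp] lemma extCoeff_natCast (s : ℕ → U →L[ℂ] Y) (n : ℕ) : extCoeff s n = s n := by
  simp [extCoeff]

@[simp] lemma extCoeff_zero (s : ℕ → U →L[ℂ] Y) : extCoeff s 0 = s 0 := extCoeff_natCast s 0

/-- The sum over a window of a finitely supported function of an integer variable. -/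
lemma finsuppSum_eq_sum_window {V G : Type*} [Zero V] [AddCommMonoid G] (f : ℤ →₀ V) {M N : ℕ}
    (hf : ∀ n ∈ f.support, -(M : ℤ) ≤ n ∧ n < N - M) (F : ℤ → V → G) (hF : ∀ n, F n 0 = 0) :
    f.sum F = ∑ i ∈ Finset.range N, F (i - M) (f (i - M)) := by
  have hinj : Function.Injective fun i : ℕ => (i : ℤ) - M := fun i j h => by
    have : (i : ℤ) - M = j - M := h
    omega
  refine Eq.trans ?_ (Finset.sum_map (Finset.range N) ⟨_, hinj⟩ fun n => F n (f n))
  refine Finset.sum_subset (fun n hn => ?_) fun n _ hn => ?_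
  · have := hf n hn
    refine Finset.mem_map.2 ⟨(n + M).toNat, ?_, ?_⟩
    · rw [Finset.mem_range]; omega
    · simp only [Function.Embedding.coeFn_mk]; omega
  · rw [Finsupp.notMem_support_iff.1 hn, hF]

lemma exists_window {V : Type*} [Zero V] (f : ℤ →₀ V) :
    ∃ M₀ : ℕ, ∀ M ≥ M₀, ∃ N : ℕ, ∀ n ∈ f.support, -(M : ℤ) ≤ n ∧ n < N - M := by
  refine ⟨f.support.sup Int.natAbs, fun M hM =>
    ⟨f.support.sup Int.natAbs + M + 1, fun n hn => ?_⟩⟩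
  have : n.natAbs ≤ f.support.sup Int.natAbs := Finset.le_sup (f := Int.natAbs) hn
  push_cast
  omega

/-- The value `2 Re ⟨h, k⟩ - ⟨P k, k⟩` for a two-sided sequence `h` and the finite sequence `k`
with entries `v 0, …, v (N - 1)` at the indices `-M, …, N - 1 - M`, where `P` is the block Laurent
matrix `[I, L; L*, I]` with symbol `∑ sₙ zⁿ`; the squares are completed. -/
def testValue (s : ℕ → U →L[ℂ] Y) (h : ℤ → WithLp 2 (Y × U)) (M N : ℕ)
    (v : ℕ → WithLp 2 (Y × U)) : ℝ :=
  ∑ j ∈ Finset.range N,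
    (‖(h (j - M)).fst - convCoeff s (fun i => (v i).snd) j‖ ^ 2 -
      ‖(h (j - M)).fst - convCoeff s (fun i => (v i).snd) j - (v j).fst‖ ^ 2 +
      ‖(h (j - M)).snd‖ ^ 2 - ‖(h (j - M)).snd - (v j).snd‖ ^ 2)

lemma completeSquare {Y U : Type*} [NormedAddCommGroup Y] [InnerProductSpace ℂ Y]
    [NormedAddCommGroup U] [InnerProductSpace ℂ U] (p c α : Y) (q β : U) :
    2 * (inner ℂ p α).re + 2 * (inner ℂ q β).re -
      (‖α‖ ^ 2 + ‖β‖ ^ 2 + 2 * (inner ℂ c α).re) =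
    ‖p - c‖ ^ 2 - ‖p - c - α‖ ^ 2 + ‖q‖ ^ 2 - ‖q - β‖ ^ 2 := by
  rw [@norm_sub_sq ℂ _ _ _ _ (p - c) α, @norm_sub_sq ℂ _ _ _ _ q β, inner_sub_left]
  simp only [RCLike.re_to_complex, Complex.sub_re]
  ring

variable [CompleteSpace U] [CompleteSpace Y]

/-- The kernel on `ℤ` with blocks `δ`, `s (m - n)`, `s (n - m)*`, `δ`: the Gram kernel of the two
orthonormal systems that meet in the Laurent matrix with symbol `∑ sₙ zⁿ`. -/
def laurentKernel (s : ℕ → U →L[ℂ] Y) :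
    Matrix ℤ ℤ (WithLp 2 (Y × U) →L[ℂ] WithLp 2 (Y × U)) :=
  Matrix.of fun m n => blockOp (if m = n then ContinuousLinearMap.id ℂ Y else 0)
    (extCoeff s (m - n)) (adjoint (extCoeff s (n - m)))
    (if m = n then ContinuousLinearMap.id ℂ U else 0)

variable (s : ℕ → U →L[ℂ] Y)

lemma laurentKernel_apply_fst (m n : ℤ) (v : WithLp 2 (Y × U)) :
    (laurentKernel s m n v).fst = (if m = n then v.fst else 0) + extCoeff s (m - n) v.snd := by
  simp only [laurentKernel, Matrix.of_apply, blockOp_fst]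
  split_ifs <;> simp

lemma laurentKernel_apply_snd (m n : ℤ) (v : WithLp 2 (Y × U)) :
    (laurentKernel s m n v).snd =
      adjoint (extCoeff s (n - m)) v.fst + (if m = n then v.snd else 0) := by
  simp only [laurentKernel, Matrix.of_apply, blockOp_snd]
  split_ifs <;> simp

lemma inner_laurentKernel (m n : ℤ) (v w : WithLp 2 (Y × U)) :
    inner ℂ (laurentKernel s m n v) w =
      (if m = n then inner ℂ v.fst w.fst + inner ℂ v.snd w.snd else 0) +
        inner ℂ (extCoeff s (m - n) v.snd) w.fst + inner ℂ v.fst (extCoeff s (n - m) w.snd) := by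
  rw [WithLp.prod_inner_apply]
  change inner ℂ (laurentKernel s m n v).fst w.fst + inner ℂ (laurentKernel s m n v).snd w.snd = _
  rw [laurentKernel_apply_fst, laurentKernel_apply_snd, inner_add_left, inner_add_left,
    adjoint_inner_left]
  split_ifs
  · ring
  · simp

lemma laurentKernel_add (m n k : ℤ) :
    laurentKernel s (m + k) (n + k) = laurentKernel s m n := by
  simp [laurentKernel]

lemma isHermitian_laurentKernel : (laurentKernel s).IsHermitian := by
  ext1 m n
  refine ContinuousLinearMap.ext fun v => ext_inner_right ℂ fun w => ?_
  rw [Matrix.conjTranspose_apply, star_eq_adjoint, adjoint_inner_left, ← inner_conj_symm,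
    inner_laurentKernel, inner_laurentKernel]
  simp only [map_add, inner_conj_symm, eq_comm (a := n)]
  split_ifs <;> simp <;> ring

omit [CompleteSpace U] [CompleteSpace Y] in
lemma sum_extCoeff (b : ℕ → U) {j N : ℕ} (hj : j < N) :
    ∑ i ∈ Finset.range N, extCoeff s (j - i) (b i) = convCoeff s b j := by
  rw [convCoeff, ← Finset.sum_subset (Finset.range_subset_range.2 (Nat.succ_le_of_lt hj))]
  · refine Finset.sum_congr rfl fun i hi => ?_
    have : i ≤ j := Nat.lt_succ_iff.1 (Finset.mem_range.1 hi)
    rw [← Nat.cast_sub this, extCoeff_natCast]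
  · intro i _ hi
    rw [Finset.mem_range] at hi
    rw [extCoeff_of_neg s (by omega)]
    rfl

/-- The quadratic form of the Laurent kernel. -/
lemma re_sum_laurentKernel (M N : ℕ) (v : ℕ → WithLp 2 (Y × U)) :
    (∑ i ∈ Finset.range N, ∑ j ∈ Finset.range N,
      inner ℂ (laurentKernel s (j - M) (i - M) (v i)) (v j)).re =
    ∑ j ∈ Finset.range N, (‖(v j).fst‖ ^ 2 + ‖(v j).snd‖ ^ 2 +
      2 * (inner ℂ (convCoeff s (fun i => (v i).snd) j) (v j).fst).re) := by
  have h1 : ∑ i ∈ Finset.range N, ∑ j ∈ Finset.range N,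
      (if (j : ℤ) - M = i - M then
        inner ℂ (v i).fst (v j).fst + inner ℂ (v i).snd (v j).snd else (0 : ℂ)) =
      ∑ j ∈ Finset.range N, (inner ℂ (v j).fst (v j).fst + inner ℂ (v j).snd (v j).snd) := by
    refine Finset.sum_congr rfl fun i hi => ?_
    rw [Finset.sum_eq_single i]
    · simp
    · intro j _ hji
      rw [if_neg (by omega)]
    · intro h; exact absurd hi h
  have h2 : ∑ i ∈ Finset.range N, ∑ j ∈ Finset.range N,
      inner ℂ (extCoeff s ((j : ℤ) - M - (i - M)) (v i).snd) (v j).fst =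
      ∑ j ∈ Finset.range N, inner ℂ (convCoeff s (fun i => (v i).snd) j) (v j).fst := by
    rw [Finset.sum_comm]
    refine Finset.sum_congr rfl fun j hj => ?_
    rw [← sum_extCoeff s _ (Finset.mem_range.1 hj), sum_inner]
    simp only [sub_sub_sub_cancel_right]
  have h3 : ∑ i ∈ Finset.range N, ∑ j ∈ Finset.range N,
      inner ℂ (v i).fst (extCoeff s ((i : ℤ) - M - (j - M)) (v j).snd) =
      ∑ j ∈ Finset.range N, inner ℂ (v j).fst (convCoeff s (fun i => (v i).snd) j) := by
    refine Finset.sum_congr rfl fun j hj => ?_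
    rw [← sum_extCoeff s _ (Finset.mem_range.1 hj), inner_sum]
    simp only [sub_sub_sub_cancel_right]
  simp only [inner_laurentKernel, Finset.sum_add_distrib] at h1 ⊢
  rw [h1, h2, h3]
  simp only [Complex.add_re, Complex.re_sum, ← Finset.sum_add_distrib]
  refine Finset.sum_congr rfl fun j _ => ?_
  have e1 := inner_self_eq_norm_sq (𝕜 := ℂ) (v j).fst
  have e2 := inner_self_eq_norm_sq (𝕜 := ℂ) (v j).snd
  have e3 := inner_re_symm (𝕜 := ℂ) (v j).fst (convCoeff s (fun i => (v i).snd) j)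
  simp only [RCLike.re_to_complex] at e1 e2 e3
  rw [e1, e2, e3]
  ring

variable {s}

/-- With `c` the Toeplitz matrix applied to `β`, the form is `‖α‖² + ‖β‖² + 2 Re ⟪c, α⟫`, which is
at least `‖α + c‖² ≥ 0` since `‖c‖ ≤ ‖β‖`. -/
lemma posSemidef_laurentKernel (hs : IsToeplitzContraction s) : (laurentKernel s).PosSemidef := by
  have htfae := (RKHS.posSemidef_tfae (K := laurentKernel s)).out 0 2
  refine htfae.2 ⟨isHermitian_laurentKernel s, fun f => ?_⟩
  obtain ⟨M, hM⟩ := exists_window f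
  obtain ⟨N, hN⟩ := hM M le_rfl
  have : (f.sum fun x w => f.sum fun x' w' => inner ℂ (laurentKernel s x' x w) w') =
      ∑ i ∈ Finset.range N, ∑ j ∈ Finset.range N,
      inner ℂ (laurentKernel s (j - M) (i - M) (f (i - M))) (f (j - M)) := by
    rw [finsuppSum_eq_sum_window f hN _ (by simp)]
    refine Finset.sum_congr rfl fun i _ => ?_
    rw [finsuppSum_eq_sum_window f hN _ (by simp)]
  rw [this, RCLike.re_to_complex, re_sum_laurentKernel s M N fun i => f (i - M)]
  have hN := hs N fun i => (f ((i : ℤ) - M)).snd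
  have hnn : 0 ≤ ∑ j ∈ Finset.range N, (‖(f ((j : ℤ) - M)).fst‖ ^ 2 +
      ‖convCoeff s (fun i => (f ((i : ℤ) - M)).snd) j‖ ^ 2 +
      2 * (inner ℂ (convCoeff s (fun i => (f ((i : ℤ) - M)).snd) j) (f ((j : ℤ) - M)).fst).re) := by
    refine Finset.sum_nonneg fun j _ => ?_
    have := @norm_add_sq ℂ _ _ _ _ (convCoeff s (fun i => (f ((i : ℤ) - M)).snd) j)
      (f ((j : ℤ) - M)).fst
    rw [RCLike.re_to_complex] at this
    nlinarith [sq_nonneg ‖convCoeff s (fun i => (f ((i : ℤ) - M)).snd) j + (f ((j : ℤ) - M)).fst‖]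
  simp only [Finset.sum_add_distrib] at hnn ⊢
  linarith

/-! ### The Hilbert space of the Laurent kernel -/

variable {H : Type*} [NormedAddCommGroup H] [InnerProductSpace ℂ H] [CompleteSpace H]
  [RKHS ℂ H ℤ (WithLp 2 (Y × U))]

lemma kerFun_total {X V H : Type*} [NormedAddCommGroup V] [InnerProductSpace ℂ V] [CompleteSpace V]
    [NormedAddCommGroup H] [InnerProductSpace ℂ H] [CompleteSpace H] [RKHS ℂ H X V] (y : H)
    (hy : ∀ x v, inner ℂ (RKHS.kerFun H x v) y = 0) : y = 0 := by
  refine RKHS.ext fun x => ext_inner_left ℂ fun v => ?_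
  rw [← RKHS.kerFun_inner, hy, RKHS.coe_zero, Pi.zero_apply, inner_zero_right]

variable (H) in
/-- The combination of kernel functions with coefficients `v 0, …, v (N - 1)` at the points
`-M, …, N - 1 - M`. -/
def testVec (M N : ℕ) (v : ℕ → WithLp 2 (Y × U)) : H :=
  ∑ i ∈ Finset.range N, RKHS.kerFun H ((i : ℤ) - M) (v i)

lemma two_re_inner_testVec (hH : RKHS.kernel H = laurentKernel s) (x : H) (M N : ℕ)
    (v : ℕ → WithLp 2 (Y × U)) :
    2 * (inner ℂ x (testVec H M N v)).re - ‖testVec H M N v‖ ^ 2 = testValue s x M N v := by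
  have h1 : ‖testVec H M N v‖ ^ 2 = ∑ j ∈ Finset.range N, (‖(v j).fst‖ ^ 2 + ‖(v j).snd‖ ^ 2 +
      2 * (inner ℂ (convCoeff s (fun i => (v i).snd) j) (v j).fst).re) := by
    rw [← re_sum_laurentKernel s M N v, ← hH, ← inner_self_eq_norm_sq (𝕜 := ℂ),
      RCLike.re_to_complex, testVec]
    simp only [sum_inner, inner_sum]
    simp only [RKHS.kernel_inner]
    rw [Finset.sum_comm]
  have h2 : 2 * (inner ℂ x (testVec H M N v)).re =
      ∑ j ∈ Finset.range N, (2 * (inner ℂ (x ((j : ℤ) - M)).fst (v j).fst).re +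
        2 * (inner ℂ (x ((j : ℤ) - M)).snd (v j).snd).re) := by
    simp only [testVec, inner_sum, RKHS.inner_kerFun, Complex.re_sum, Finset.mul_sum]
    refine Finset.sum_congr rfl fun j _ => ?_
    rw [WithLp.prod_inner_apply, Complex.add_re, mul_add]
    rfl
  rw [h1, h2, ← Finset.sum_sub_distrib]
  exact Finset.sum_congr rfl fun j _ => completeSquare _ _ _ _ _

lemma testValue_eq (hH : RKHS.kernel H = laurentKernel s) (x : H) (M N : ℕ)
    (v : ℕ → WithLp 2 (Y × U)) :
    testValue s x M N v = ‖x‖ ^ 2 - ‖x - testVec H M N v‖ ^ 2 := by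
  rw [← two_re_inner_testVec hH, @norm_sub_sq ℂ, RCLike.re_to_complex]
  ring

lemma testValue_le (hH : RKHS.kernel H = laurentKernel s) (x : H) (M N : ℕ)
    (v : ℕ → WithLp 2 (Y × U)) : testValue s x M N v ≤ ‖x‖ ^ 2 := by
  rw [testValue_eq hH]
  linarith [sq_nonneg ‖x - testVec H M N v‖]

lemma synthesis_kerFun_eq {f : ℤ →₀ WithLp 2 (Y × U)} {M N : ℕ}
    (hf : ∀ n ∈ f.support, -(M : ℤ) ≤ n ∧ n < N - M) :
    synthesis (RKHS.kerFun H) f = testVec H M N fun i => f (i - M) := by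
  rw [synthesis_apply, finsuppSum_eq_sum_window f hf _ (by simp), testVec]

/-- The squared norm is the supremum of the test values. -/
lemma exists_testValue_ge (hH : RKHS.kernel H = laurentKernel s) (x : H) {ε : ℝ} (hε : 0 < ε) :
    ∃ M₀ : ℕ, ∀ M ≥ M₀, ∃ N v, ‖x‖ ^ 2 - ε ≤ testValue s x M N v := by
  obtain ⟨f, hf⟩ := (denseRange_synthesis (kerFun_total (H := H))).exists_dist_lt x
    (Real.sqrt_pos.2 hε)
  obtain ⟨M₀, hM₀⟩ := exists_window f
  refine ⟨M₀, fun M hM => ?_⟩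
  obtain ⟨N, hN⟩ := hM₀ M hM
  refine ⟨N, fun i => f (i - M), ?_⟩
  rw [testValue_eq hH, ← synthesis_kerFun_eq hN]
  rw [dist_eq_norm, Real.lt_sqrt (norm_nonneg _)] at hf
  linarith

/-- A two-sided sequence with bounded test values belongs to the space. -/
theorem exists_coe_eq (hH : RKHS.kernel H = laurentKernel s) {h : ℤ → WithLp 2 (Y × U)} {K : ℝ}
    (hK : ∀ M N v, testValue s h M N v ≤ K) : ∃ x : H, ⇑x = h := by
  set T : (ℤ →₀ WithLp 2 (Y × U)) →ₗ[ℂ] H := synthesis (RKHS.kerFun H) with hT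
  set φ : (ℤ →₀ WithLp 2 (Y × U)) →ₗ[ℂ] ℂ :=
    Finsupp.lsum ℂ fun n => (innerSL ℂ (h n)).toLinearMap with hφ
  have h1 : ∀ f, 2 * (φ f).re - ‖T f‖ ^ 2 ≤ K := by
    intro f
    obtain ⟨M, hM⟩ := exists_window f
    obtain ⟨N, hN⟩ := hM M le_rfl
    refine le_of_eq_of_le ?_ (hK M N fun i => f (i - M))
    have e0 := two_re_inner_testVec hH (0 : H) M N fun i => f (i - M)
    have e1 : (φ f).re = ∑ j ∈ Finset.range N, ((inner ℂ (h (j - M)).fst (f (j - M)).fst).re +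
        (inner ℂ (h (j - M)).snd (f (j - M)).snd).re) := by
      have : φ f = f.sum fun n v => inner ℂ (h n) v := rfl
      rw [this, finsuppSum_eq_sum_window f hN _ (by simp), Complex.re_sum]
      refine Finset.sum_congr rfl fun j _ => ?_
      rw [WithLp.prod_inner_apply, Complex.add_re]
      rfl
    have e2 : testValue s h M N (fun i => f (i - M)) -
        testValue s (0 : H) M N (fun i => f (i - M)) = 2 * (φ f).re := by
      rw [e1, testValue, testValue, ← Finset.sum_sub_distrib, Finset.mul_sum]
      refine Finset.sum_congr rfl fun j _ => ?_
      rw [← completeSquare, ← completeSquare]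
      simp
      ring
    rw [inner_zero_left, ← synthesis_kerFun_eq hN] at e0
    simp only [Complex.zero_re, mul_zero, zero_sub] at e0
    rw [← e2, ← e0]
    ring
  have hK0 : 0 ≤ K := by simpa using h1 0
  -- apply `h1` to the multiples of `f` and optimize: `φ` factors through a bounded functional on
  -- the combinations of kernel functions, whose Riesz representative has the entries of `h`
  have h2 : ∀ f, ‖φ f‖ ≤ √K * ‖T f‖ := by
    intro f
    have h3 : ∀ t : ℝ, 2 * t * ‖φ f‖ ^ 2 - t ^ 2 * ‖φ f‖ ^ 2 * ‖T f‖ ^ 2 ≤ K := by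
      intro t
      have := h1 (((t : ℂ) * conj (φ f)) • f)
      rw [map_smul, map_smul, norm_smul, smul_eq_mul, mul_assoc, Complex.conj_mul',
        norm_mul, RCLike.norm_conj, Complex.norm_real, mul_pow, mul_pow, Real.norm_eq_abs,
        sq_abs] at this
      have e : ((t : ℂ) * (‖φ f‖ : ℂ) ^ 2).re = t * ‖φ f‖ ^ 2 := by
        rw [← Complex.ofReal_pow, ← Complex.ofReal_mul, Complex.ofReal_re]
      rw [e] at this
      linarith
    have h4 : ‖φ f‖ ^ 2 ≤ K * ‖T f‖ ^ 2 := by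
      rcases eq_or_ne (‖T f‖ ^ 2) 0 with h0 | h0
      · rw [h0, mul_zero]
        by_contra hc
        push Not at hc
        have := h3 ((K + 1) / (2 * ‖φ f‖ ^ 2))
        rw [h0, mul_zero, sub_zero] at this
        have e : 2 * ((K + 1) / (2 * ‖φ f‖ ^ 2)) * ‖φ f‖ ^ 2 = K + 1 := by
          have hne : ‖φ f‖ ≠ 0 := fun h => by simp [h] at hc
          field_simp
        linarith
      · have := h3 (‖T f‖ ^ 2)⁻¹
        have e : 2 * (‖T f‖ ^ 2)⁻¹ * ‖φ f‖ ^ 2 -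
            (‖T f‖ ^ 2)⁻¹ ^ 2 * ‖φ f‖ ^ 2 * ‖T f‖ ^ 2 = ‖φ f‖ ^ 2 / ‖T f‖ ^ 2 := by
          field_simp
          ring
        rw [e] at this
        have hpos : 0 < ‖T f‖ ^ 2 := lt_of_le_of_ne (by positivity) h0.symm
        exact (div_le_iff₀ hpos).1 this
    calc ‖φ f‖ = √(‖φ f‖ ^ 2) := (Real.sqrt_sq (norm_nonneg _)).symm
      _ ≤ √(K * ‖T f‖ ^ 2) := Real.sqrt_le_sqrt h4
      _ = √K * ‖T f‖ := by rw [Real.sqrt_mul hK0, Real.sqrt_sq (norm_nonneg _)]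
  set Φ := φ.extendOfNorm T with hΦ
  refine ⟨(InnerProductSpace.toDual ℂ H).symm Φ, ?_⟩
  funext n
  refine ext_inner_right ℂ fun v => ?_
  rw [← RKHS.inner_kerFun, InnerProductSpace.toDual_symm_apply]
  have e1 : RKHS.kerFun H n v = T (Finsupp.single n v) := by simp [hT, synthesis]
  rw [e1, hΦ, LinearMap.extendOfNorm_eq (denseRange_synthesis (kerFun_total (H := H))) ⟨√K, h2⟩]
  simp [hφ]

/-- The bilateral shift is unitary on the space. -/
theorem exists_bilateralShift (hH : RKHS.kernel H = laurentKernel s) :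
    ∃ W : H ≃ₗᵢ[ℂ] H, (∀ x n, (W x) n = x (n - 1)) ∧ ∀ x n, (W.symm x) n = x (n + 1) := by
  obtain ⟨W, hW⟩ := exists_linearIsometryEquiv_of_gram
    (e₁ := fun n => RKHS.kerFun H n) (e₂ := fun n : ℤ => RKHS.kerFun H (n + 1))
    (kerFun_total (H := H))
    (fun y hy => kerFun_total y fun x v => by simpa using hy (x - 1) v) (by
      intro m n v w
      rw [← RKHS.kernel_inner, ← RKHS.kernel_inner, hH, laurentKernel_add])
  have h1 : ∀ x n, (W x) (n + 1) = x n := fun x n => by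
    refine ext_inner_left ℂ fun v => ?_
    rw [← RKHS.kerFun_inner, ← hW, LinearIsometryEquiv.inner_map_map, RKHS.kerFun_inner]
  refine ⟨W, fun x n => ?_, fun x n => ?_⟩
  · simpa using h1 x (n - 1)
  · rw [← h1, W.apply_symm_apply]

end Kernel

/-! ### The space `D(S)` as a closed subspace of the Laurent space -/

section Window

variable {U : Type u} [NormedAddCommGroup U] [InnerProductSpace ℂ U]
  {Y : Type v} [NormedAddCommGroup Y] [InnerProductSpace ℂ Y]

/-- The two-sided sequence of a pair of power series: `f = ∑ aₙ zⁿ` occupies the first component at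
the indices `n ≥ 0`, and `g = ∑ bₙ zⁿ` the second component at the indices `-n - 1 < 0`. -/
def pairSeq (a : ℕ → Y) (b : ℕ → U) : ℤ → WithLp 2 (Y × U)
  | (n : ℕ) => WithLp.toLp 2 (a n, 0)
  | Int.negSucc n => WithLp.toLp 2 (0, b n)

omit [InnerProductSpace ℂ U] [InnerProductSpace ℂ Y] in
@[simp] lemma pairSeq_natCast (a : ℕ → Y) (b : ℕ → U) (n : ℕ) :
    pairSeq a b n = WithLp.toLp 2 (a n, 0) := rfl

omit [InnerProductSpace ℂ U] [InnerProductSpace ℂ Y] in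
@[simp] lemma pairSeq_negSucc (a : ℕ → Y) (b : ℕ → U) (n : ℕ) :
    pairSeq a b (Int.negSucc n) = WithLp.toLp 2 (0, b n) := rfl

omit [InnerProductSpace ℂ U] [InnerProductSpace ℂ Y] in
lemma pairSeq_sub_fst (a : ℕ → Y) (b : ℕ → U) (j n : ℕ) :
    (pairSeq a b ((j : ℤ) - n)).fst = if n ≤ j then a (j - n) else 0 := by
  split_ifs with h
  · rw [← Nat.cast_sub h, pairSeq_natCast]; rfl
  · rw [show (j : ℤ) - n = Int.negSucc (n - 1 - j) by omega, pairSeq_negSucc]; rfl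

omit [InnerProductSpace ℂ U] [InnerProductSpace ℂ Y] in
lemma pairSeq_sub_snd (a : ℕ → Y) (b : ℕ → U) (j n : ℕ) :
    (pairSeq a b ((j : ℤ) - n)).snd = if j < n then b (n - 1 - j) else 0 := by
  split_ifs with h
  · rw [show (j : ℤ) - n = Int.negSucc (n - 1 - j) by omega, pairSeq_negSucc]; rfl
  · rw [← Nat.cast_sub (not_lt.1 h), pairSeq_natCast]; rfl

omit [InnerProductSpace ℂ U] [InnerProductSpace ℂ Y] in
lemma sum_pairSeq_sub_snd (a : ℕ → Y) (b : ℕ → U) {n N : ℕ} (h : n ≤ N) :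
    ∑ j ∈ Finset.range N, ‖(pairSeq a b ((j : ℤ) - n)).snd‖ ^ 2 =
      ∑ k ∈ Finset.range n, ‖b k‖ ^ 2 := by
  rw [← Finset.sum_range_reflect (fun k => ‖b k‖ ^ 2) n,
    ← Finset.sum_subset (Finset.range_subset_range.2 h)]
  · refine Finset.sum_congr rfl fun j hj => ?_
    rw [pairSeq_sub_snd, if_pos (Finset.mem_range.1 hj)]
  · intro j _ hj
    rw [pairSeq_sub_snd, if_neg (by simpa using hj)]
    simp

omit [InnerProductSpace ℂ U] [InnerProductSpace ℂ Y] in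
lemma sum_pairSeq_sub_snd_le (a : ℕ → Y) (b : ℕ → U) (n N : ℕ) :
    ∑ j ∈ Finset.range N, ‖(pairSeq a b ((j : ℤ) - n)).snd‖ ^ 2 ≤
      ∑ k ∈ Finset.range n, ‖b k‖ ^ 2 := by
  rw [← sum_pairSeq_sub_snd a b (le_max_left n N)]
  exact Finset.sum_le_sum_of_subset_of_nonneg (Finset.range_subset_range.2 (le_max_right n N))
    fun _ _ _ => by positivity

lemma convCoeff_sub (s : ℕ → U →L[ℂ] Y) (b c : ℕ → U) (j : ℕ) :
    convCoeff s (fun i => b i - c i) j = convCoeff s b j - convCoeff s c j := by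
  simp [convCoeff, Finset.sum_sub_distrib]

lemma convCoeff_congr (s : ℕ → U →L[ℂ] Y) {b c : ℕ → U} {j : ℕ} (h : ∀ i ≤ j, b i = c i) :
    convCoeff s b j = convCoeff s c j :=
  Finset.sum_congr rfl fun i hi => by rw [h i (Nat.lt_succ_iff.1 (Finset.mem_range.1 hi))]

@[simp] lemma convCoeff_zero (s : ℕ → U →L[ℂ] Y) (j : ℕ) : convCoeff s (fun _ => 0) j = 0 := by
  simp [convCoeff]

lemma IsToeplitzContraction.summable {s : ℕ → U →L[ℂ] Y} (hs : IsToeplitzContraction s) {b : ℕ → U}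
    (hb : Summable fun n => ‖b n‖ ^ 2) : Summable fun n => ‖convCoeff s b n‖ ^ 2 :=
  summable_of_sum_range_le (fun _ => by positivity) fun N =>
    (hs N b).trans (hb.sum_le_tsum _ fun _ _ => by positivity)

/-- The coefficients of `zⁿ f(z) - S(z) (b₀ zⁿ⁻¹ + ⋯ + bₙ₋₁)`. -/
def shiftedCoeff (s : ℕ → U →L[ℂ] Y) (a : ℕ → Y) (b : ℕ → U) (n j : ℕ) : Y :=
  (pairSeq a b ((j : ℤ) - n)).fst - convCoeff s (fun i => (pairSeq a b ((i : ℤ) - n)).snd) j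

/-- The test values of a pair in terms of the functions that enter the definition of `H(S)`. -/
lemma testValue_pairSeq (s : ℕ → U →L[ℂ] Y) (a : ℕ → Y) (b : ℕ → U) (n N : ℕ)
    (v : ℕ → WithLp 2 (Y × U)) (G : ℕ → U)
    (hG : ∀ i, G i = (pairSeq a b ((i : ℤ) - n)).snd - (v i).snd) :
    testValue s (pairSeq a b) n N v =
      ∑ j ∈ Finset.range N, ‖shiftedCoeff s a b n j + convCoeff s G j‖ ^ 2 -
      ∑ j ∈ Finset.range N, ‖shiftedCoeff s a b n j + convCoeff s G j - (v j).fst‖ ^ 2 +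
      ∑ j ∈ Finset.range N, ‖(pairSeq a b ((j : ℤ) - n)).snd‖ ^ 2 -
      ∑ j ∈ Finset.range N, ‖G j‖ ^ 2 := by
  rw [testValue, ← Finset.sum_sub_distrib, ← Finset.sum_add_distrib, ← Finset.sum_sub_distrib]
  refine Finset.sum_congr rfl fun j _ => ?_
  have : convCoeff s (fun i => (v i).snd) j =
      convCoeff s (fun i => (pairSeq a b ((i : ℤ) - n)).snd) j - convCoeff s G j := by
    rw [← convCoeff_sub]
    exact convCoeff_congr s fun i _ => by rw [hG, sub_sub_cancel]
  rw [this, hG j, shiftedCoeff, ← sub_add]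

variable [CompleteSpace Y] {S : ℂ → U →L[ℂ] Y}

lemma IsSchur.hasTaylor_shifted (hS : IsSchur S) {a : ℕ → Y} {f : 𝔻 → Y} (ha : HasTaylor a f)
    (b : ℕ → U) (n : ℕ) :
    HasTaylor (shiftedCoeff (opCoeff S) a b n) (shifted S f b n) := by
  have h1 := ha.pow_smul n
  have h2 := hS.hasTaylor_mul (hasTaylor_sum_range (fun i => b (n - 1 - i)) n)
  convert h1.sub h2 using 1
  · funext j
    simp only [shiftedCoeff, Pi.sub_apply, pairSeq_sub_fst, pairSeq_sub_snd]
  · funext z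
    simp only [shifted, Pi.sub_apply]
    congr 2
    rw [← Finset.sum_range_reflect]
    refine Finset.sum_congr rfl fun i hi => ?_
    rw [Finset.mem_range] at hi
    rw [show n - 1 - (n - 1 - i) = i by omega]

/-- Each test value on the indices `≥ -n` is bounded by `Nₙ`. -/
lemma IsSchur.testValue_le_of_memH (hS : IsSchur S) {a : ℕ → Y} {f : 𝔻 → Y} (ha : HasTaylor a f)
    (b : ℕ → U) (n : ℕ) (hF : MemH S (shifted S f b n)) (N : ℕ) (v : ℕ → WithLp 2 (Y × U)) :
    testValue (opCoeff S) (pairSeq a b) n N v ≤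
      hNormSq S (shifted S f b n) + ∑ k ∈ Finset.range n, ‖b k‖ ^ 2 := by
  set s := opCoeff S
  set G : ℕ → U := fun i => (pairSeq a b ((i : ℤ) - n)).snd - (v i).snd with hG
  set G' : ℕ → U := fun i => if i < N then G i else 0 with hG'
  have hFT := hS.hasTaylor_shifted ha b n
  have hgT := hasTaylor_sum_range G N
  set g : 𝔻 → U := fun z => ∑ j ∈ Finset.range N, (z : ℂ) ^ j • G j
  have hG'0 : ∀ j ∉ Finset.range N, ‖G' j‖ ^ 2 = 0 := fun j hj => by
    simp [hG', Finset.mem_range.not.1 hj]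
  have hgs : Summable fun j => ‖G' j‖ ^ 2 := summable_of_ne_finset_zero hG'0
  have hgH : MemHardy g := ⟨G', hgT, hgs⟩
  have hsumT : HasTaylor (shiftedCoeff s a b n + convCoeff s G')
      (fun z => shifted S f b n z + S z (g z)) := hFT.add (hS.hasTaylor_mul hgT)
  have hle : hardyNormSq (fun z => shifted S f b n z + S z (g z)) - hardyNormSq g ≤
      hNormSq S (shifted S f b n) := le_csSup hF.2 ⟨g, hgH, rfl⟩
  have hsum : Summable fun j => ‖(shiftedCoeff s a b n + convCoeff s G') j‖ ^ 2 := by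
    have h1 : Summable fun j => ‖shiftedCoeff s a b n j‖ ^ 2 := hFT.memHardy_iff.1 hF.1
    have h2 := hS.isToeplitzContraction.summable hgs
    refine Summable.of_nonneg_of_le (fun _ => by positivity) (fun j => ?_)
      ((h1.mul_left 2).add (h2.mul_left 2))
    have := norm_add_le (shiftedCoeff s a b n j) (convCoeff s G' j)
    rw [Pi.add_apply]
    have h3 := sq_nonneg (‖shiftedCoeff s a b n j‖ - ‖convCoeff s G' j‖)
    have h4 := pow_le_pow_left₀ (norm_nonneg _) this 2
    linarith
  have hg2 : hardyNormSq g = ∑ j ∈ Finset.range N, ‖G j‖ ^ 2 := by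
    rw [hgT.hardyNormSq_eq, tsum_eq_sum hG'0]
    exact Finset.sum_congr rfl fun j hj => by simp [hG', Finset.mem_range.1 hj]
  have hF2 : ∑ j ∈ Finset.range N, ‖shiftedCoeff s a b n j + convCoeff s G j‖ ^ 2 ≤
      hardyNormSq (fun z => shifted S f b n z + S z (g z)) := by
    rw [hsumT.hardyNormSq_eq]
    refine le_trans (le_of_eq (Finset.sum_congr rfl fun j hj => ?_))
      (hsum.sum_le_tsum (Finset.range N) fun _ _ => by positivity)
    rw [Pi.add_apply, convCoeff_congr s (b := G) (c := G')]
    intro i hi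
    simp [hG', lt_of_le_of_lt hi (Finset.mem_range.1 hj)]
  rw [testValue_pairSeq s a b n N v G fun _ => rfl]
  have h5 := sum_pairSeq_sub_snd_le a b n N
  have h6 : 0 ≤ ∑ j ∈ Finset.range N,
      ‖shiftedCoeff s a b n j + convCoeff s G j - (v j).fst‖ ^ 2 :=
    Finset.sum_nonneg fun _ _ => by positivity
  linarith

omit [CompleteSpace Y] in
/-- If the test values on the indices `≥ -n` are bounded by `K`, then so are all the numbers whose
supremum is `Nₙ`. -/
lemma sum_shiftedCoeff_le {s : ℕ → U →L[ℂ] Y} {a : ℕ → Y} {b : ℕ → U} {n : ℕ} {K : ℝ}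
    (hK : ∀ N v, testValue s (pairSeq a b) n N v ≤ K) {G : ℕ → U}
    (hG : Summable fun j => ‖G j‖ ^ 2) (N : ℕ) :
    ∑ j ∈ Finset.range N, ‖shiftedCoeff s a b n j + convCoeff s G j‖ ^ 2 ≤
      K - ∑ k ∈ Finset.range n, ‖b k‖ ^ 2 + ∑' j, ‖G j‖ ^ 2 := by
  set N' := max n N
  have h1 := hK N' fun i => WithLp.toLp 2 (shiftedCoeff s a b n i + convCoeff s G i,
    (pairSeq a b ((i : ℤ) - n)).snd - G i)
  rw [testValue_pairSeq s a b n N' _ G fun i => by simp,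
    sum_pairSeq_sub_snd a b (le_max_left n N)] at h1
  have h2 : ∑ j ∈ Finset.range N, ‖shiftedCoeff s a b n j + convCoeff s G j‖ ^ 2 ≤
      ∑ j ∈ Finset.range N', ‖shiftedCoeff s a b n j + convCoeff s G j‖ ^ 2 :=
    Finset.sum_le_sum_of_subset_of_nonneg (Finset.range_subset_range.2 (le_max_right n N))
      fun _ _ _ => by positivity
  have h3 : ∑ j ∈ Finset.range N', ‖G j‖ ^ 2 ≤ ∑' j, ‖G j‖ ^ 2 :=
    hG.sum_le_tsum _ fun _ _ => by positivity
  have h4 : ∑ j ∈ Finset.range N', ‖shiftedCoeff s a b n j + convCoeff s G j -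
      (shiftedCoeff s a b n j + convCoeff s G j)‖ ^ 2 = 0 := by simp
  simp only [WithLp.toLp_fst, h4] at h1
  linarith

omit [CompleteSpace Y] in
lemma sum_shiftedCoeff_le' {s : ℕ → U →L[ℂ] Y} {a : ℕ → Y} {b : ℕ → U} {n : ℕ} {K : ℝ}
    (hK : ∀ N v, testValue s (pairSeq a b) n N v ≤ K) (N : ℕ) :
    ∑ j ∈ Finset.range N, ‖shiftedCoeff s a b n j‖ ^ 2 ≤
      K - ∑ k ∈ Finset.range n, ‖b k‖ ^ 2 := by
  simpa using sum_shiftedCoeff_le hK (G := fun _ => 0) (by simp) N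

/-- If the test values on the indices `≥ -n` are bounded by `K`, then `Nₙ ≤ K`. -/
lemma IsSchur.memH_of_testValue_le (hS : IsSchur S) {a : ℕ → Y} {f : 𝔻 → Y} (ha : HasTaylor a f)
    (b : ℕ → U) (n : ℕ) {K : ℝ}
    (hK : ∀ N v, testValue (opCoeff S) (pairSeq a b) n N v ≤ K) :
    MemH S (shifted S f b n) ∧
      hNormSq S (shifted S f b n) + ∑ k ∈ Finset.range n, ‖b k‖ ^ 2 ≤ K := by
  have hFT := hS.hasTaylor_shifted ha b n
  have hbd : ∀ r ∈ hsValues S (shifted S f b n), r ≤ K - ∑ k ∈ Finset.range n, ‖b k‖ ^ 2 := by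
    rintro r ⟨g, hg, rfl⟩
    have hsumT : HasTaylor (shiftedCoeff (opCoeff S) a b n + convCoeff (opCoeff S) (taylorCoeff g))
        (fun z => shifted S f b n z + S z (g z)) := hFT.add (hS.hasTaylor_mul hg.hasTaylor)
    rw [hsumT.hardyNormSq_eq]
    have := Real.tsum_le_of_sum_range_le (fun _ => by positivity)
      (sum_shiftedCoeff_le hK hg.summable)
    rw [hardyNormSq]
    simp only [Pi.add_apply]
    linarith
  have hmem : MemHardy (shifted S f b n) := hFT.memHardy_iff.2
    (summable_of_sum_range_le (fun _ => by positivity) (sum_shiftedCoeff_le' hK))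
  refine ⟨⟨hmem, _, hbd⟩, ?_⟩
  have hne : (hsValues S (shifted S f b n)).Nonempty :=
    ⟨_, fun _ => 0, ⟨fun _ => 0, fun z => by simp,
      by simp⟩, rfl⟩
  have := csSup_le hne hbd
  rw [hNormSq]
  linarith

end Window

section Model

variable {U : Type u} [NormedAddCommGroup U] [InnerProductSpace ℂ U] [CompleteSpace U]
  {Y : Type v} [NormedAddCommGroup Y] [InnerProductSpace ℂ Y] [CompleteSpace Y]
  {S : ℂ → U →L[ℂ] Y}
  {H : Type*} [NormedAddCommGroup H] [InnerProductSpace ℂ H] [CompleteSpace H]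
  [RKHS ℂ H ℤ (WithLp 2 (Y × U))]

/-- A pair of power series belongs to `D(S)` when its two-sided sequence belongs to the Laurent
space. -/
theorem IsSchur.memD_iff (hS : IsSchur S) (hH : RKHS.kernel H = laurentKernel (opCoeff S))
    {F : 𝔻 → WithLp 2 (Y × U)} {a : ℕ → Y} {b : ℕ → U} (ha : HasTaylor a fun z => (F z).fst)
    (hb : HasTaylor b fun z => (F z).snd) : MemD S F ↔ ∃ x : H, ⇑x = pairSeq a b := by
  constructor
  · rintro ⟨-, -, hmem, K, hK⟩
    refine exists_coe_eq hH (K := K) fun M N v => ?_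
    refine le_trans ?_ (hK ⟨M, rfl⟩)
    rw [dSeq]
    have := hmem M
    rw [hb.taylorCoeff_eq] at this ⊢
    exact hS.testValue_le_of_memH ha b M this N v
  · rintro ⟨x, hx⟩
    have hK : ∀ n N v, testValue (opCoeff S) (pairSeq a b) n N v ≤ ‖x‖ ^ 2 := fun n N v => by
      rw [← hx]; exact testValue_le hH x n N v
    refine ⟨ha.memHardy_iff.2 (summable_of_sum_range_le (c := ‖x‖ ^ 2) (fun _ => by positivity)
        fun N => ?_),
      hb.memHardy_iff.2 (summable_of_sum_range_le (c := ‖x‖ ^ 2) (fun _ => by positivity)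
        fun N => ?_), fun n => ?_, ‖x‖ ^ 2, ?_⟩
    · have := sum_shiftedCoeff_le' (hK 0) N
      simpa [shiftedCoeff] using this
    · have := sum_shiftedCoeff_le' (hK N) 0
      simpa using this
    · rw [hb.taylorCoeff_eq]
      exact (hS.memH_of_testValue_le ha b n (hK n)).1
    · rintro _ ⟨n, rfl⟩
      rw [dSeq, hb.taylorCoeff_eq]
      exact (hS.memH_of_testValue_le ha b n (hK n)).2

/-- The numbers `Nₙ` converge to the squared norm in the Laurent space. -/
theorem IsSchur.tendsto_dSeq (hS : IsSchur S) (hH : RKHS.kernel H = laurentKernel (opCoeff S))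
    {F : 𝔻 → WithLp 2 (Y × U)} {a : ℕ → Y} {b : ℕ → U} (ha : HasTaylor a fun z => (F z).fst)
    (hb : HasTaylor b fun z => (F z).snd) {x : H} (hx : ⇑x = pairSeq a b) :
    Tendsto (dSeq S (fun z => (F z).fst) fun z => (F z).snd) atTop (𝓝 (‖x‖ ^ 2)) := by
  have hK : ∀ n N v, testValue (opCoeff S) (pairSeq a b) n N v ≤ ‖x‖ ^ 2 := fun n N v => by
    rw [← hx]; exact testValue_le hH x n N v
  refine tendsto_order.2 ⟨fun c hc => ?_, fun c hc => ?_⟩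
  · obtain ⟨M₀, hM₀⟩ := exists_testValue_ge hH x (ε := (‖x‖ ^ 2 - c) / 2) (by linarith)
    filter_upwards [eventually_ge_atTop M₀] with n hn
    obtain ⟨N, v, hv⟩ := hM₀ n hn
    have h1 := hS.testValue_le_of_memH ha b n (hS.memH_of_testValue_le ha b n (hK n)).1 N v
    rw [dSeq, hb.taylorCoeff_eq]
    rw [hx] at hv
    linarith
  · refine Eventually.of_forall fun n => ?_
    rw [dSeq, hb.taylorCoeff_eq]
    exact (hS.memH_of_testValue_le ha b n (hK n)).2.trans_lt hc

variable (H) in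
/-- The elements of the Laurent space that are sequences of pairs of power series: the first
component is supported on `n ≥ 0`, the second on `n < 0`. -/
def modelSubmodule : Submodule ℂ H where
  carrier := {x | ∀ n : ℕ, (x (Int.negSucc n)).fst = 0 ∧ (x (n : ℤ)).snd = 0}
  add_mem' hx hy n := by simp [hx n, hy n]
  zero_mem' n := by simp
  smul_mem' c x hx n := by simp [hx n]

omit [CompleteSpace U] [CompleteSpace Y] [CompleteSpace H] in
lemma mem_modelSubmodule {x : H} : x ∈ modelSubmodule H ↔
    ∀ n : ℕ, (x (Int.negSucc n)).fst = 0 ∧ (x (n : ℤ)).snd = 0 := Iff.rfl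

omit [CompleteSpace U] [CompleteSpace Y] [CompleteSpace H] in
lemma isClosed_modelSubmodule : IsClosed (modelSubmodule H : Set H) := by
  have : (modelSubmodule H : Set H) =
      ⋂ n : ℕ, {x | (x (Int.negSucc n)).fst = 0} ∩ {x | (x (n : ℤ)).snd = 0} := by
    ext x
    simp [mem_modelSubmodule]
  rw [this]
  refine isClosed_iInter fun n => IsClosed.inter ?_ ?_
  · exact isClosed_eq ((WithLp.fstL 2 ℂ Y U).continuous.comp (RKHS.continuous_eval _))
      continuous_const
  · exact isClosed_eq ((WithLp.sndL 2 ℂ Y U).continuous.comp (RKHS.continuous_eval _))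
      continuous_const

instance : CompleteSpace (modelSubmodule H) :=
  isClosed_modelSubmodule.completeSpace_coe

omit [CompleteSpace U] [CompleteSpace Y] [CompleteSpace H] in
lemma coe_eq_pairSeq {x : H} (hx : x ∈ modelSubmodule H) :
    ⇑x = pairSeq (fun n => (x (n : ℤ)).fst) (fun n => (x (Int.negSucc n)).snd) := by
  funext n
  cases n with
  | ofNat n =>
    refine (WithLp.ofLp_injective 2) (Prod.ext rfl ?_)
    exact (hx n).2
  | negSucc n =>
    refine (WithLp.ofLp_injective 2) (Prod.ext ?_ rfl)
    exact (hx n).1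

lemma exists_norm_apply_le (hH : RKHS.kernel H = laurentKernel (opCoeff S)) :
    ∃ C, 0 ≤ C ∧ ∀ (x : H) (n : ℤ), ‖x n‖ ≤ C * ‖x‖ := by
  refine ⟨√‖laurentKernel (opCoeff S) 0 0‖, Real.sqrt_nonneg _, fun x n => ?_⟩
  have := RKHS.norm_apply_le x n
  rwa [hH, ← zero_add n, laurentKernel_add, mul_comm, zero_add] at this

/-- Evaluation at `z` of the power series with coefficients `L n x`. -/
lemma exists_evalCLM {E G : Type*} [NormedAddCommGroup E] [NormedSpace ℂ E] [NormedAddCommGroup G]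
    [NormedSpace ℂ G] [CompleteSpace G] {L : ℕ → E →L[ℂ] G} {C : ℝ} (hC : 0 ≤ C)
    (hL : ∀ n x, ‖L n x‖ ≤ C * ‖x‖) (z : 𝔻) :
    ∃ T : E →L[ℂ] G, ∀ x, T x = ∑' n, (z : ℂ) ^ n • L n x := by
  have hsum : Summable fun n => (z : ℂ) ^ n • L n :=
    Summable.of_norm_bounded
    ((summable_geometric_of_lt_one (norm_nonneg _) z.norm_lt_one).mul_right C) fun n => by
      rw [norm_smul, norm_pow]
      gcongr
      exact ContinuousLinearMap.opNorm_le_bound _ hC (hL n)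
  refine ⟨∑' n, (z : ℂ) ^ n • L n, fun x => ?_⟩
  have := (ContinuousLinearMap.apply ℂ G x).hasSum hsum.hasSum
  simpa using this.tsum_eq.symm

/-- The pair of functions on the disk of an element of the model subspace. -/
def evalFun (x : H) (z : 𝔻) : WithLp 2 (Y × U) :=
  WithLp.toLp 2 (∑' n : ℕ, (z : ℂ) ^ n • (x (n : ℤ)).fst,
    ∑' n : ℕ, (z : ℂ) ^ n • (x (Int.negSucc n)).snd)

lemma hasTaylor_evalFun_fst (hH : RKHS.kernel H = laurentKernel (opCoeff S)) (x : H) :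
    HasTaylor (fun n : ℕ => (x (n : ℤ)).fst) fun z => (evalFun x z).fst := by
  obtain ⟨C, -, h⟩ := exists_norm_apply_le hH
  exact hasTaylor_tsum fun n => (WithLp.norm_fst_le _ _).trans (h x n)

lemma hasTaylor_evalFun_snd (hH : RKHS.kernel H = laurentKernel (opCoeff S)) (x : H) :
    HasTaylor (fun n : ℕ => (x (Int.negSucc n)).snd) fun z => (evalFun x z).snd := by
  obtain ⟨C, -, h⟩ := exists_norm_apply_le hH
  exact hasTaylor_tsum fun n => (WithLp.norm_snd_le _ _).trans (h x _)

lemma exists_evalFun_eq (hH : RKHS.kernel H = laurentKernel (opCoeff S)) (z : 𝔻) :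
    ∃ T : H →L[ℂ] WithLp 2 (Y × U), ∀ x, T x = evalFun x z := by
  obtain ⟨C, hC, h⟩ := exists_norm_apply_le hH
  let e : ℤ → H →L[ℂ] WithLp 2 (Y × U) := fun n => (.proj n : (ℤ → WithLp 2 (Y × U)) →L[ℂ] _) ∘L
    RKHS.coeCLM ℂ
  have he : ∀ n x, e n x = x n := fun n x => rfl
  obtain ⟨T₁, hT₁⟩ := exists_evalCLM hC (L := fun n : ℕ => WithLp.fstL 2 ℂ Y U ∘L e n)
    (fun n x => (WithLp.norm_fst_le _ (e n x)).trans (h x n)) z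
  obtain ⟨T₂, hT₂⟩ := exists_evalCLM hC (L := fun n : ℕ => WithLp.sndL 2 ℂ Y U ∘L e (Int.negSucc n))
    (fun n x => (WithLp.norm_snd_le _ (e (Int.negSucc n) x)).trans (h x _)) z
  let T : H →L[ℂ] WithLp 2 (Y × U) :=
    (WithLp.prodContinuousLinearEquiv 2 ℂ Y U).symm.toContinuousLinearMap ∘L T₁.prod T₂
  have hT : ∀ x, T x = WithLp.toLp 2 (T₁ x, T₂ x) := fun x => rfl
  refine ⟨T, fun x => ?_⟩
  rw [hT, hT₁, hT₂]
  rfl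

lemma memD_evalFun (hS : IsSchur S) (hH : RKHS.kernel H = laurentKernel (opCoeff S)) {x : H}
    (hx : x ∈ modelSubmodule H) : MemD S (evalFun x) :=
  (hS.memD_iff hH (F := evalFun x) (hasTaylor_evalFun_fst hH x) (hasTaylor_evalFun_snd hH x)).2
    ⟨x, coe_eq_pairSeq hx⟩

/-- An element of the model subspace as an element of `D(S)`. -/
def toDSpace (hS : IsSchur S) (hH : RKHS.kernel H = laurentKernel (opCoeff S))
    (x : modelSubmodule H) : DSpace S :=
  ⟨evalFun (x : H), memD_evalFun hS hH x.2⟩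

lemma bijective_toDSpace (hS : IsSchur S) (hH : RKHS.kernel H = laurentKernel (opCoeff S)) :
    Function.Bijective (toDSpace (H := H) hS hH) := by
  constructor
  · intro x y hxy
    have h : evalFun (x : H) = evalFun (y : H) := congrArg DSpace.toFun hxy
    have h1 := (hasTaylor_evalFun_fst hH (x : H)).coeff_unique
      (h ▸ hasTaylor_evalFun_fst hH (y : H))
    have h2 := (hasTaylor_evalFun_snd hH (x : H)).coeff_unique
      (h ▸ hasTaylor_evalFun_snd hH (y : H))
    refine Subtype.ext (DFunLike.coe_injective ?_)
    rw [coe_eq_pairSeq x.2, coe_eq_pairSeq y.2, h1, h2]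
  · rintro ⟨F, hF⟩
    obtain ⟨x, hx⟩ := (hS.memD_iff hH hF.1.hasTaylor hF.2.1.hasTaylor).1 hF
    have hxm : x ∈ modelSubmodule H := fun n => by simp [hx]
    refine ⟨⟨x, hxm⟩, DSpace.ext (funext fun z => ?_)⟩
    refine (WithLp.ofLp_injective 2) (Prod.ext ?_ ?_)
    · refine ((hasTaylor_evalFun_fst hH x) z).unique ?_
      simpa [hx] using hF.1.hasTaylor z
    · refine ((hasTaylor_evalFun_snd hH x) z).unique ?_
      simpa [hx] using hF.2.1.hasTaylor z

omit [CompleteSpace U] [CompleteSpace Y] in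
/-- Transport of a Hilbert space structure to `D(S)`. -/
theorem exists_structure {M : Type*} [NormedAddCommGroup M] [InnerProductSpace ℂ M]
    [CompleteSpace M] (E : DSpace S ≃ M) (ev : 𝔻 → M →L[ℂ] WithLp 2 (Y × U))
    (hev : ∀ z F, ev z (E F) = F.toFun z)
    (hnorm : ∀ F : DSpace S, Tendsto (dSeq S (fun z => (F.toFun z).fst) fun z => (F.toFun z).snd)
      atTop (𝓝 (‖E F‖ ^ 2))) :
    ∃ (_ : NormedAddCommGroup (DSpace S)) (_ : InnerProductSpace ℂ (DSpace S))
      (_ : CompleteSpace (DSpace S)) (_ : RKHS ℂ (DSpace S) 𝔻 (WithLp 2 (Y × U))),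
      IsDStructure S ∧ ∃ L : DSpace S ≃ₗᵢ[ℂ] M, ∀ F, L F = E F := by
  let acg : AddCommGroup (DSpace S) := E.addCommGroup
  let mod : Module ℂ (DSpace S) := E.module ℂ
  let L₀ : DSpace S ≃ₗ[ℂ] M := E.linearEquiv ℂ
  have hL₀ : ∀ F, L₀ F = E F := fun F => rfl
  let nacg : NormedAddCommGroup (DSpace S) :=
    NormedAddCommGroup.induced (DSpace S) M L₀ L₀.injective
  have hn : ∀ F : DSpace S, ‖F‖ = ‖L₀ F‖ := fun F => rfl
  let ips : InnerProductSpace ℂ (DSpace S) :=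
    { mod with
      norm_smul_le := fun c F => by rw [hn, hn, map_smul, norm_smul]
      inner := fun F G => inner ℂ (L₀ F) (L₀ G)
      norm_sq_eq_re_inner := fun F => norm_sq_eq_re_inner (𝕜 := ℂ) (L₀ F)
      conj_inner_symm := fun F G => inner_conj_symm (L₀ F) (L₀ G)
      add_left := fun F G K => by
        change inner ℂ (L₀ (F + G)) (L₀ K) = inner ℂ (L₀ F) (L₀ K) + inner ℂ (L₀ G) (L₀ K)
        rw [map_add, inner_add_left]
      smul_left := fun F G c => by
        change inner ℂ (L₀ (c • F)) (L₀ G) = _ * inner ℂ (L₀ F) (L₀ G)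
        rw [map_smul, inner_smul_left] }
  let L : DSpace S ≃ₗᵢ[ℂ] M := { L₀ with norm_map' := fun F => rfl }
  have hL : ∀ F, L F = E F := fun F => rfl
  have hc : CompleteSpace (DSpace S) :=
    L.toIsometryEquiv.completeSpace
  let coe : DSpace S →L[ℂ] 𝔻 → WithLp 2 (Y × U) :=
    .pi fun z => ev z ∘L L.toContinuousLinearEquiv.toContinuousLinearMap
  have hcoe : ∀ F, coe F = F.toFun := fun F => funext fun z => hev z F
  let rk : RKHS ℂ (DSpace S) 𝔻 (WithLp 2 (Y × U)) :=
    { coeCLM := coe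
      coeCLM_injective := fun F G h => DSpace.ext (by rw [← hcoe, ← hcoe]; exact h) }
  exact ⟨nacg, ips, hc, rk, ⟨hcoe, hnorm⟩, L, hL⟩

end Model

/-! ### Unitary colligations -/

lemma withLp_ext {E F : Type*} {x y : WithLp 2 (E × F)} (h₁ : x.fst = y.fst)
    (h₂ : x.snd = y.snd) : x = y :=
  WithLp.ofLp_injective 2 (Prod.ext h₁ h₂)

section Block

variable {E F E' F' : Type*}
  [NormedAddCommGroup E] [InnerProductSpace ℂ E] [CompleteSpace E]
  [NormedAddCommGroup F] [InnerProductSpace ℂ F] [CompleteSpace F]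
  [NormedAddCommGroup E'] [InnerProductSpace ℂ E'] [CompleteSpace E']
  [NormedAddCommGroup F'] [InnerProductSpace ℂ F'] [CompleteSpace F']

omit [CompleteSpace E] [CompleteSpace F] in
lemma inner_eq_add (x y : WithLp 2 (E × F)) :
    inner ℂ x y = inner ℂ x.fst y.fst + inner ℂ x.snd y.snd := WithLp.prod_inner_apply x y

lemma adjoint_blockOp (A : E →L[ℂ] E') (B : F →L[ℂ] E') (C : E →L[ℂ] F') (D : F →L[ℂ] F') :
    adjoint (blockOp A B C D) = blockOp (adjoint A) (adjoint C) (adjoint B) (adjoint D) := by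
  refine ((ContinuousLinearMap.eq_adjoint_iff _ _).2 fun x y => ?_).symm
  simp only [inner_eq_add, blockOp_fst, blockOp_snd, inner_add_left, inner_add_right,
    adjoint_inner_left]
  ring

omit [CompleteSpace E] [CompleteSpace F] [CompleteSpace E'] [CompleteSpace F'] in
lemma blockOp_comp_eq_id_iff (A : E →L[ℂ] E') (B : F →L[ℂ] E') (C : E →L[ℂ] F') (D : F →L[ℂ] F')
    (A' : E' →L[ℂ] E) (B' : F' →L[ℂ] E) (C' : E' →L[ℂ] F) (D' : F' →L[ℂ] F) :
    blockOp A' B' C' D' ∘L blockOp A B C D = ContinuousLinearMap.id ℂ _ ↔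
      (∀ x, A' (A x) + B' (C x) = x) ∧ (∀ u, A' (B u) + B' (D u) = 0) ∧
      (∀ x, C' (A x) + D' (C x) = 0) ∧ ∀ u, C' (B u) + D' (D u) = u := by
  constructor
  · intro h
    have h1 : ∀ p, blockOp A' B' C' D' (blockOp A B C D p) = p := fun p =>
      congrArg (fun T => T p) h
    refine ⟨fun x => ?_, fun u => ?_, fun x => ?_, fun u => ?_⟩
    · simpa using congrArg WithLp.fst (h1 (WithLp.toLp 2 (x, 0)))
    · simpa using congrArg WithLp.fst (h1 (WithLp.toLp 2 (0, u)))
    · simpa using congrArg WithLp.snd (h1 (WithLp.toLp 2 (x, 0)))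
    · simpa using congrArg WithLp.snd (h1 (WithLp.toLp 2 (0, u)))
  · rintro ⟨h1, h2, h3, h4⟩
    refine ContinuousLinearMap.ext fun p => withLp_ext ?_ ?_
    · simp only [comp_apply, blockOp_fst, blockOp_snd, map_add, id_apply]
      rw [add_add_add_comm, h1, h2, add_zero]
    · simp only [comp_apply, blockOp_fst, blockOp_snd, map_add, id_apply]
      rw [add_add_add_comm, h3, h4, zero_add]

/-- The entries of a unitary block operator. -/
lemma isUnitaryOp_blockOp_iff (A : E →L[ℂ] E') (B : F →L[ℂ] E') (C : E →L[ℂ] F')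
    (D : F →L[ℂ] F') : IsUnitaryOp (blockOp A B C D) ↔
    ((∀ x, adjoint A (A x) + adjoint C (C x) = x) ∧ (∀ u, adjoint A (B u) + adjoint C (D u) = 0) ∧
      (∀ x, adjoint B (A x) + adjoint D (C x) = 0) ∧ ∀ u, adjoint B (B u) + adjoint D (D u) = u) ∧
    ((∀ x, A (adjoint A x) + B (adjoint B x) = x) ∧ (∀ y, A (adjoint C y) + B (adjoint D y) = 0) ∧
      (∀ x, C (adjoint A x) + D (adjoint B x) = 0) ∧
      ∀ y, C (adjoint C y) + D (adjoint D y) = y) := by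
  rw [IsUnitaryOp, adjoint_blockOp, blockOp_comp_eq_id_iff, blockOp_comp_eq_id_iff]

lemma IsUnitaryOp.adjoint {V : E →L[ℂ] F} (h : IsUnitaryOp V) :
    IsUnitaryOp (ContinuousLinearMap.adjoint V) := by
  rw [IsUnitaryOp, adjoint_adjoint]
  exact ⟨h.2, h.1⟩

lemma isUnitaryOp_of_norm_eq {V : E →L[ℂ] F} (h : ∀ x, ‖V x‖ = ‖x‖)
    (hV : Function.Surjective V) : IsUnitaryOp V := by
  have h1 : ∀ x, ContinuousLinearMap.adjoint V (V x) = x := fun x =>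
    congrArg (fun T => T x) ((ContinuousLinearMap.norm_map_iff_adjoint_comp_self V).1 h)
  refine ⟨ContinuousLinearMap.ext h1, ContinuousLinearMap.ext fun y => ?_⟩
  obtain ⟨x, rfl⟩ := hV y
  exact congrArg V (h1 x)

end Block

section Resolvent

variable {X : Type*} [NormedAddCommGroup X] [InnerProductSpace ℂ X] [CompleteSpace X]

/-- The resolvent `(1 - z A)⁻¹`. -/
def res (A : X →L[ℂ] X) (z : ℂ) : X →L[ℂ] X := Ring.inverse (1 - z • A)

variable {A : X →L[ℂ] X}

lemma norm_smul_lt_one (hA : ‖A‖ ≤ 1) (z : 𝔻) : ‖(z : ℂ) • A‖ < 1 := by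
  rw [norm_smul]
  exact (mul_le_of_le_one_right (norm_nonneg _) hA).trans_lt z.norm_lt_one

lemma isUnit_one_sub_smul (hA : ‖A‖ ≤ 1) (z : 𝔻) : IsUnit (1 - (z : ℂ) • A) :=
  isUnit_one_sub_of_norm_lt_one (norm_smul_lt_one hA z)

lemma res_mul (hA : ‖A‖ ≤ 1) (z : 𝔻) : res A z * (1 - (z : ℂ) • A) = 1 :=
  Ring.inverse_mul_cancel _ (isUnit_one_sub_smul hA z)

lemma mul_res (hA : ‖A‖ ≤ 1) (z : 𝔻) : (1 - (z : ℂ) • A) * res A z = 1 :=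
  Ring.mul_inverse_cancel _ (isUnit_one_sub_smul hA z)

lemma res_apply_sub (hA : ‖A‖ ≤ 1) (z : 𝔻) (x : X) : res A z (x - (z : ℂ) • A x) = x :=
  congrArg (fun T => T x) (res_mul hA z)

lemma sub_res_apply (hA : ‖A‖ ≤ 1) (z : 𝔻) (x : X) :
    res A z x - (z : ℂ) • A (res A z x) = x :=
  congrArg (fun T => T x) (mul_res hA z)

lemma res_eq_of_sub_eq (hA : ‖A‖ ≤ 1) (z : 𝔻) {x y : X} (h : y - (z : ℂ) • A y = x) :
    res A z x = y := by
  rw [← h, res_apply_sub hA]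

lemma adjoint_res (hA : ‖A‖ ≤ 1) (z : 𝔻) :
    adjoint (res A z) = res (adjoint A) (conj (z : ℂ)) := by
  have hA' : ‖adjoint A‖ ≤ 1 := by rwa [LinearIsometryEquiv.norm_map]
  refine ContinuousLinearMap.ext fun x => ?_
  refine (res_eq_of_sub_eq hA' (star z) ?_).symm
  have h : adjoint (res A z * (1 - (z : ℂ) • A)) x = x := by
    rw [res_mul hA, ← star_eq_adjoint, star_one]; rfl
  rw [← star_eq_adjoint, star_mul, star_sub, star_one, star_smul] at h
  exact h

/-- The Neumann series. -/
lemma hasSum_res (hA : ‖A‖ ≤ 1) (z : 𝔻) (x : X) :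
    HasSum (fun n : ℕ => (z : ℂ) ^ n • (A ^ n) x) (res A z x) := by
  have h2 := (ContinuousLinearMap.apply ℂ X x).hasSum
    (hasSum_geom_series_inverse _ (norm_smul_lt_one hA z))
  simpa [smul_pow, res] using h2

/-- The resolvent identity. -/
lemma smul_res_sub (hA : ‖A‖ ≤ 1) (z w : 𝔻) :
    (z : ℂ) • res A z - (w : ℂ) • res A w = ((z : ℂ) - w) • (res A z * res A w) := by
  have h : (z : ℂ) • (1 - (w : ℂ) • A) - (w : ℂ) • (1 - (z : ℂ) • A) = ((z : ℂ) - w) • 1 := by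
    rw [smul_sub, smul_sub, smul_smul, smul_smul, mul_comm (w : ℂ), sub_smul]
    abel
  calc (z : ℂ) • res A z - (w : ℂ) • res A w
      = (z : ℂ) • (res A z * ((1 - (w : ℂ) • A) * res A w)) -
        (w : ℂ) • ((res A z * (1 - (z : ℂ) • A)) * res A w) := by
        rw [mul_res hA, res_mul hA, mul_one, one_mul]
    _ = res A z * ((z : ℂ) • (1 - (w : ℂ) • A) - (w : ℂ) • (1 - (z : ℂ) • A)) * res A w := by
        generalize 1 - (w : ℂ) • A = P
        generalize 1 - (z : ℂ) • A = Q
        rw [mul_sub, sub_mul, mul_smul_comm, mul_smul_comm, smul_mul_assoc, smul_mul_assoc,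
          mul_assoc, mul_assoc]
    _ = _ := by rw [h, mul_smul_comm, mul_one, smul_mul_assoc]

lemma tendsto_res (hA : ‖A‖ ≤ 1) (w : 𝔻) : Tendsto (res A) (𝓝 (w : ℂ)) (𝓝 (res A w)) := by
  obtain ⟨v, hv⟩ := isUnit_one_sub_smul hA w
  have h1 := NormedRing.inverse_continuousAt v
  rw [hv] at h1
  exact h1.tendsto.comp ((by fun_prop : Continuous fun z : ℂ => (1 - z • A)).tendsto _)

end Resolvent

section Colligation

variable {U : Type*} [NormedAddCommGroup U] [InnerProductSpace ℂ U] [CompleteSpace U]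
  {Y : Type*} [NormedAddCommGroup Y] [InnerProductSpace ℂ Y] [CompleteSpace Y]
  {X : Type*} [NormedAddCommGroup X] [InnerProductSpace ℂ X] [CompleteSpace X]

/-- The colligation `[A, B; C, D]` is unitary and `S` is its transfer function on the disk. -/
structure IsUnitaryRealization (A : X →L[ℂ] X) (B : U →L[ℂ] X) (C : X →L[ℂ] Y) (D : U →L[ℂ] Y)
    (S : ℂ → U →L[ℂ] Y) : Prop where
  unitary : IsUnitaryOp (blockOp A B C D)
  transfer : ∀ z : 𝔻, S z = D + (z : ℂ) • (C ∘L res A z ∘L B)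

namespace IsUnitaryRealization

variable {A : X →L[ℂ] X} {B : U →L[ℂ] X} {C : X →L[ℂ] Y} {D : U →L[ℂ] Y} {S : ℂ → U →L[ℂ] Y}

lemma norm_sq_add (h : IsUnitaryRealization A B C D S) (x : X) :
    ‖A x‖ ^ 2 + ‖C x‖ ^ 2 = ‖x‖ ^ 2 := by
  have h1 := ((isUnitaryOp_blockOp_iff _ _ _ _).1 h.unitary).1.1 x
  have h2 : inner ℂ x x = inner ℂ (A x) (A x) + inner ℂ (C x) (C x) := by
    rw [← adjoint_inner_left, ← adjoint_inner_left, ← inner_add_left, h1]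
  rw [← inner_self_eq_norm_sq (𝕜 := ℂ), ← inner_self_eq_norm_sq (𝕜 := ℂ),
    ← inner_self_eq_norm_sq (𝕜 := ℂ), h2, map_add]

lemma norm_le_one (h : IsUnitaryRealization A B C D S) : ‖A‖ ≤ 1 := by
  refine ContinuousLinearMap.opNorm_le_bound _ zero_le_one fun x => ?_
  rw [one_mul]
  have := h.norm_sq_add x
  exact abs_le_of_sq_le_sq' (by nlinarith [sq_nonneg ‖C x‖]) (norm_nonneg _) |>.2

/-- The adjoint colligation realizes `S̃`. -/
lemma dual (h : IsUnitaryRealization A B C D S) :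
    IsUnitaryRealization (adjoint A) (adjoint C) (adjoint B) (adjoint D) (tilde S) where
  unitary := by
    rw [← adjoint_blockOp]
    exact h.unitary.adjoint
  transfer z := by
    have h1 := h.transfer (star z)
    rw [Complex.UnitDisc.coe_star] at h1
    rw [tilde, h1, map_add, LinearIsometryEquiv.map_smulₛₗ, adjoint_comp, adjoint_comp,
      ← Complex.UnitDisc.coe_star, adjoint_res h.norm_le_one]
    simp [comp_assoc]

/-- The diagonal blocks of the kernel. -/
lemma kS_eq (h : IsUnitaryRealization A B C D S) (z w : 𝔻) :
    kS S z w = C ∘L res A z ∘L res (adjoint A) (conj (w : ℂ)) ∘L adjoint C := by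
  have hA := h.norm_le_one
  have hA' := h.dual.norm_le_one
  obtain ⟨-, e1, e2, e3, e4⟩ := (isUnitaryOp_blockOp_iff _ _ _ _).1 h.unitary
  have hne : (1 : ℂ) - z * conj (w : ℂ) ≠ 0 := by
    intro h0
    have := (z * star w).coe_ne_one
    rw [Complex.UnitDisc.coe_mul, Complex.UnitDisc.coe_star] at this
    exact this (sub_eq_zero.1 h0).symm
  refine ContinuousLinearMap.ext fun y => ?_
  set p := res (adjoint A) (conj (w : ℂ)) (adjoint C y) with hp
  have hp1 : p - conj (w : ℂ) • adjoint A p = adjoint C y :=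
    sub_res_apply hA' (star w) _
  have hSw : adjoint (S w) y = adjoint D y + conj (w : ℂ) • adjoint B p := by
    have := congrArg (fun T => T y) (h.dual.transfer (star w))
    simpa [tilde] using this
  have hB : B (adjoint (S w) y) = conj (w : ℂ) • p - A p := by
    have h1 : B (adjoint D y) = -A (adjoint C y) := by
      rw [eq_neg_iff_add_eq_zero, add_comm]; exact e2 y
    have h2 : B (adjoint B p) = p - A (adjoint A p) := by
      rw [eq_sub_iff_add_eq, add_comm]; exact e1 p
    rw [hSw, map_add, map_smul, h1, h2, ← hp1, map_sub, map_smul, smul_sub]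
    abel
  have hD : D (adjoint (S w) y) = y - C p := by
    have h1 : D (adjoint D y) = y - C (adjoint C y) := by
      rw [eq_sub_iff_add_eq, add_comm]; exact e4 y
    have h2 : D (adjoint B p) = -C (adjoint A p) := by
      rw [eq_neg_iff_add_eq_zero, add_comm]; exact e3 p
    rw [hSw, map_add, map_smul, h1, h2, ← hp1, map_sub, map_smul, smul_neg]
    abel
  have hz : (z : ℂ) • res A z (A p) = res A z p - p := by
    have := res_apply_sub hA z p
    rw [map_sub, map_smul] at this
    nth_rewrite 3 [← this]
    abel
  have hS : S z (adjoint (S w) y) = y - (1 - (z : ℂ) * conj (w : ℂ)) • C (res A z p) := by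
    rw [h.transfer z]
    simp only [add_apply, smul_apply, comp_apply]
    rw [hB, hD, map_sub, map_smul, map_sub, map_smul, smul_sub, smul_smul, ← map_smul C (z : ℂ),
      hz, map_sub, sub_smul, one_smul]
    abel
  simp only [kS, smul_apply, sub_apply, id_apply, comp_apply]
  rw [hS, sub_sub_cancel, smul_smul, inv_mul_cancel₀ hne, one_smul]

lemma sub_eq (h : IsUnitaryRealization A B C D S) (z w : 𝔻) :
    S z - S w = ((z : ℂ) - w) • (C ∘L res A z ∘L res A w ∘L B) := by
  have h1 : ((z : ℂ) • (C ∘L res A z ∘L B)) - (w : ℂ) • (C ∘L res A w ∘L B) =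
      C ∘L ((z : ℂ) • res A z - (w : ℂ) • res A w) ∘L B := by
    ext u; simp
  rw [h.transfer z, h.transfer w, add_sub_add_left_eq_sub, h1, smul_res_sub h.norm_le_one]
  ext u; simp

lemma hasDerivAt (h : IsUnitaryRealization A B C D S) (w : 𝔻) :
    HasDerivAt S (C ∘L res A w ∘L res A w ∘L B) (w : ℂ) := by
  rw [hasDerivAt_iff_tendsto_slope]
  have h1 : Tendsto (fun z => C ∘L res A z ∘L res A w ∘L B) (𝓝[≠] (w : ℂ))
      (𝓝 (C ∘L res A w ∘L res A w ∘L B)) := by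
    have h2 := (tendsto_res h.norm_le_one w).mono_left
      (nhdsWithin_le_nhds (s := {(w : ℂ)}ᶜ))
    have hc : Continuous fun T : X →L[ℂ] X => C ∘L T ∘L res A w ∘L B := by fun_prop
    exact (hc.tendsto _).comp h2
  refine h1.congr' ?_
  have hball : Metric.ball (0 : ℂ) 1 ∈ 𝓝 (w : ℂ) :=
    Metric.isOpen_ball.mem_nhds (by simpa using w.norm_lt_one)
  filter_upwards [self_mem_nhdsWithin, mem_nhdsWithin_of_mem_nhds hball] with z hz hz1
  have hz1' : ‖z‖ < 1 := by simpa using hz1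
  have hne : z - w ≠ 0 := sub_ne_zero.2 hz
  have := h.sub_eq (Complex.UnitDisc.mk z hz1') w
  rw [Complex.UnitDisc.coe_mk] at this
  rw [slope_def_module, this, smul_smul, inv_mul_cancel₀ hne, one_smul]

/-- The off-diagonal blocks of the kernel. -/
lemma dslope_eq (h : IsUnitaryRealization A B C D S) (z w : 𝔻) :
    dslope S (w : ℂ) (z : ℂ) = C ∘L res A z ∘L res A w ∘L B := by
  rcases eq_or_ne (z : ℂ) w with hzw | hzw
  · rw [hzw, dslope_same, (h.hasDerivAt w).deriv]
  · rw [dslope_of_ne _ hzw, slope_def_module, h.sub_eq, smul_smul,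
      inv_mul_cancel₀ (sub_ne_zero.2 hzw), one_smul]

/-- The transfer function of a unitary colligation is a Schur function. -/
theorem isSchur (h : IsUnitaryRealization A B C D S) : IsSchur S := by
  refine ⟨fun z hz => ?_, fun z hz => ?_⟩
  · have hz' : ‖z‖ < 1 := by simpa using hz
    exact (h.hasDerivAt (Complex.UnitDisc.mk z hz')).differentiableAt.differentiableWithinAt
  · have hz' : ‖z‖ < 1 := by simpa using hz
    set w : 𝔻 := Complex.UnitDisc.mk z hz'
    have hw : (w : ℂ) = z := rfl
    rw [← hw, ← LinearIsometryEquiv.norm_map adjoint]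
    refine ContinuousLinearMap.opNorm_le_bound _ zero_le_one fun y => ?_
    have hne : (1 : ℂ) - w * conj (w : ℂ) ≠ 0 := by
      intro h0
      have := (w * star w).coe_ne_one
      rw [Complex.UnitDisc.coe_mul, Complex.UnitDisc.coe_star] at this
      exact this (sub_eq_zero.1 h0).symm
    have h1 : y - S w (adjoint (S w) y) = (1 - (w : ℂ) * conj (w : ℂ)) • kS S w w y := by
      simp [kS, smul_smul, mul_inv_cancel₀ hne]
    have h2 : (inner ℂ (kS S w w y) y).re = ‖adjoint (res A w) (adjoint C y)‖ ^ 2 := by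
      rw [h.kS_eq, ← adjoint_res h.norm_le_one]
      simp only [comp_apply]
      rw [← adjoint_inner_right, ← adjoint_inner_right, ← RCLike.re_to_complex,
        inner_self_eq_norm_sq (𝕜 := ℂ)]
    have h3 : ‖y‖ ^ 2 - ‖adjoint (S w) y‖ ^ 2 =
        (1 - ‖(w : ℂ)‖ ^ 2) * ‖adjoint (res A w) (adjoint C y)‖ ^ 2 := by
      rw [← h2, ← inner_self_eq_norm_sq (𝕜 := ℂ) y,
        ← inner_self_eq_norm_sq (𝕜 := ℂ) (adjoint (S w) y), adjoint_inner_right, ← map_sub,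
        ← inner_sub_left, h1, inner_smul_left, Complex.mul_conj', RCLike.re_to_complex]
      rw [show conj ((1 : ℂ) - (‖(w : ℂ)‖ : ℂ) ^ 2) = ((1 - ‖(w : ℂ)‖ ^ 2 : ℝ) : ℂ) by
        simp, Complex.re_ofReal_mul]
    have h4 : 0 ≤ (1 - ‖(w : ℂ)‖ ^ 2) * ‖adjoint (res A w) (adjoint C y)‖ ^ 2 :=
      mul_nonneg (by linarith [w.sq_norm_lt_one]) (by positivity)
    rw [one_mul]
    exact abs_le_of_sq_le_sq' (by linarith) (norm_nonneg _) |>.2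

end IsUnitaryRealization

/-- The map `x ↦ (C (1 - z A)⁻¹ x, B* (1 - z A*)⁻¹ x)`, the value at `z` of the pair of functions
that a colligation attaches to the state `x`. -/
def stateEval (A : X →L[ℂ] X) (B : U →L[ℂ] X) (C : X →L[ℂ] Y) (z : ℂ) :
    X →L[ℂ] WithLp 2 (Y × U) :=
  (WithLp.prodContinuousLinearEquiv 2 ℂ Y U).symm.toContinuousLinearMap ∘L
    (C ∘L res A z).prod (adjoint B ∘L res (adjoint A) z)

omit [CompleteSpace Y] in
@[simp] lemma stateEval_fst (A : X →L[ℂ] X) (B : U →L[ℂ] X) (C : X →L[ℂ] Y) (z : ℂ) (x : X) :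
    (stateEval A B C z x).fst = C (res A z x) := rfl

omit [CompleteSpace Y] in
@[simp] lemma stateEval_snd (A : X →L[ℂ] X) (B : U →L[ℂ] X) (C : X →L[ℂ] Y) (z : ℂ) (x : X) :
    (stateEval A B C z x).snd = adjoint B (res (adjoint A) z x) := rfl

namespace IsUnitaryRealization

variable {A : X →L[ℂ] X} {B : U →L[ℂ] X} {C : X →L[ℂ] Y} {D : U →L[ℂ] Y} {S : ℂ → U →L[ℂ] Y}

lemma adjoint_stateEval_apply (h : IsUnitaryRealization A B C D S) (w : 𝔻)
    (v : WithLp 2 (Y × U)) : adjoint (stateEval A B C w) v =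
      res (adjoint A) (conj (w : ℂ)) (adjoint C v.fst) + res A (conj (w : ℂ)) (B v.snd) := by
  refine ext_inner_right ℂ fun x => ?_
  have e := adjoint_res h.dual.norm_le_one w
  rw [adjoint_adjoint] at e
  rw [adjoint_inner_left, inner_eq_add, stateEval_fst, stateEval_snd, inner_add_left,
    ← adjoint_res h.norm_le_one, ← e, adjoint_inner_left, adjoint_inner_left,
    adjoint_inner_left, adjoint_inner_right]

/-- The Gram kernel of the maps `stateEval` is the block kernel of the transfer function. -/
theorem stateEval_comp_adjoint (h : IsUnitaryRealization A B C D S) (z w : 𝔻) :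
    stateEval A B C z ∘L adjoint (stateEval A B C w) = kHat S z w := by
  have e2 : dslope S (conj (w : ℂ)) z = C ∘L res A z ∘L res A (conj (w : ℂ)) ∘L B :=
    h.dslope_eq z (star w)
  have e3 : dslope (tilde S) (conj (w : ℂ)) z =
      adjoint B ∘L res (adjoint A) z ∘L res (adjoint A) (conj (w : ℂ)) ∘L adjoint C :=
    h.dual.dslope_eq z (star w)
  have e4 := h.dual.kS_eq z w
  rw [adjoint_adjoint, adjoint_adjoint] at e4
  refine ContinuousLinearMap.ext fun v => withLp_ext ?_ ?_
  · rw [comp_apply, h.adjoint_stateEval_apply, stateEval_fst, kHat, Matrix.of_apply, blockOp_fst,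
      h.kS_eq, e2]
    simp
  · rw [comp_apply, h.adjoint_stateEval_apply, stateEval_snd, kHat, Matrix.of_apply, blockOp_snd,
      e4, e3]
    simp

lemma hasTaylor_stateEval_fst (h : IsUnitaryRealization A B C D S) (x : X) :
    HasTaylor (fun n => C ((A ^ n) x)) fun z => (stateEval A B C z x).fst := fun z => by
  simpa using C.hasSum (hasSum_res h.norm_le_one z x)

lemma hasTaylor_stateEval_snd (h : IsUnitaryRealization A B C D S) (x : X) :
    HasTaylor (fun n => adjoint B ((adjoint A ^ n) x)) fun z => (stateEval A B C z x).snd :=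
  h.dual.hasTaylor_stateEval_fst x

/-- The state operator acts on the pairs of functions as `R̂₀`. -/
theorem hatR_stateEval (h : IsUnitaryRealization A B C D S) (x : X) :
    hatR S (fun z => stateEval A B C z x) = fun z : 𝔻 => stateEval A B C z (A x) := by
  obtain ⟨⟨e1, -, e3, -⟩, -⟩ := (isUnitaryOp_blockOp_iff _ _ _ _).1 h.unitary
  funext z
  refine withLp_ext ?_ ?_
  · have h1 := (h.hasTaylor_stateEval_fst x).backwardShift z
    have h2 := h.hasTaylor_stateEval_fst (A x) z
    refine h1.unique ?_
    simpa [pow_succ] using h2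
  · have h0 : (stateEval A B C ((0 : 𝔻) : ℂ) x).fst = C x := by
      simpa using (h.hasTaylor_stateEval_fst x).apply_zero
    have hA' := h.dual.norm_le_one
    have ht : tilde S z (C x) = adjoint D (C x) +
        (z : ℂ) • adjoint B (res (adjoint A) z (adjoint C (C x))) := by
      rw [h.dual.transfer z]; rfl
    have e3' : adjoint D (C x) = -adjoint B (A x) := by
      rw [eq_neg_iff_add_eq_zero, add_comm]; exact e3 x
    have e1' : adjoint C (C x) = x - adjoint A (A x) := by
      rw [eq_sub_iff_add_eq, add_comm]; exact e1 x
    have h5 := res_apply_sub hA' z (A x)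
    rw [map_sub, map_smul] at h5
    have h6 := congrArg (adjoint B) h5
    rw [map_sub, map_smul] at h6
    simp only [hatR, WithLp.toLp_snd, stateEval_snd]
    rw [h0, ht, e3', e1', map_sub, map_sub, smul_sub, ← h6]
    abel

end IsUnitaryRealization

end Colligation

/-! ### The canonical colligation on the model subspace -/

section Inclusions

variable (E F : Type*) [NormedAddCommGroup E] [InnerProductSpace ℂ E]
  [NormedAddCommGroup F] [InnerProductSpace ℂ F]

/-- The inclusion of the first summand. -/
def inFst : E →L[ℂ] WithLp 2 (E × F) :=
  (WithLp.prodContinuousLinearEquiv 2 ℂ E F).symm.toContinuousLinearMap ∘L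
    ContinuousLinearMap.inl ℂ E F

/-- The inclusion of the second summand. -/
def inSnd : F →L[ℂ] WithLp 2 (E × F) :=
  (WithLp.prodContinuousLinearEquiv 2 ℂ E F).symm.toContinuousLinearMap ∘L
    ContinuousLinearMap.inr ℂ E F

@[simp] lemma inFst_apply (x : E) : inFst E F x = WithLp.toLp 2 (x, 0) := rfl

@[simp] lemma inSnd_apply (x : F) : inSnd E F x = WithLp.toLp 2 (0, x) := rfl

end Inclusions

section ModelOperators

variable {U : Type u} [NormedAddCommGroup U] [InnerProductSpace ℂ U] [CompleteSpace U]
  {Y : Type v} [NormedAddCommGroup Y] [InnerProductSpace ℂ Y] [CompleteSpace Y]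
  {S : ℂ → U →L[ℂ] Y}
  {H : Type*} [NormedAddCommGroup H] [InnerProductSpace ℂ H] [CompleteSpace H]
  [RKHS ℂ H ℤ (WithLp 2 (Y × U))]

variable (H) in
/-- `w ↦ w - k₋₁ (p, 0)`, where `p` is the first component of `w (-1)`: the projection along the
vectors `k₋₁ (y, 0)`. -/
def projNegOne : H →L[ℂ] H :=
  ContinuousLinearMap.id ℂ H - RKHS.kerFun H (-1) ∘L inFst Y U ∘L WithLp.fstL 2 ℂ Y U ∘L
    adjoint (RKHS.kerFun H (-1))

lemma projNegOne_apply (w : H) :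
    projNegOne H w = w - RKHS.kerFun H (-1) (WithLp.toLp 2 ((w (-1)).fst, 0)) := by
  simp [projNegOne]

variable (H) in
/-- `w ↦ w - k₀ (0, q)`, where `q` is the second component of `w 0`. -/
def projZero : H →L[ℂ] H :=
  ContinuousLinearMap.id ℂ H - RKHS.kerFun H 0 ∘L inSnd Y U ∘L WithLp.sndL 2 ℂ Y U ∘L
    adjoint (RKHS.kerFun H 0)

lemma projZero_apply (w : H) :
    projZero H w = w - RKHS.kerFun H 0 (WithLp.toLp 2 (0, (w 0).snd)) := by
  simp [projZero]

variable {s : ℕ → U →L[ℂ] Y}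

lemma kerFun_fst (hH : RKHS.kernel H = laurentKernel s) (m n : ℤ) (v : WithLp 2 (Y × U)) :
    (RKHS.kerFun H n v m).fst = (if m = n then v.fst else 0) + extCoeff s (m - n) v.snd := by
  rw [RKHS.kerFun_apply, hH, laurentKernel_apply_fst]

lemma kerFun_snd (hH : RKHS.kernel H = laurentKernel s) (m n : ℤ) (v : WithLp 2 (Y × U)) :
    (RKHS.kerFun H n v m).snd =
      adjoint (extCoeff s (n - m)) v.fst + (if m = n then v.snd else 0) := by
  rw [RKHS.kerFun_apply, hH, laurentKernel_apply_snd]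

lemma norm_projNegOne_sq (hH : RKHS.kernel H = laurentKernel s) (w : H) :
    ‖projNegOne H w‖ ^ 2 = ‖w‖ ^ 2 - ‖(w (-1)).fst‖ ^ 2 := by
  have h1 : ‖RKHS.kerFun H (-1) (WithLp.toLp 2 ((w (-1)).fst, (0 : U)))‖ ^ 2 =
      ‖(w (-1)).fst‖ ^ 2 := by
    rw [← inner_self_eq_norm_sq (𝕜 := ℂ), RKHS.kerFun_inner, inner_eq_add, kerFun_fst hH]
    simp [← Complex.ofReal_pow]
  have h2 : inner ℂ w (RKHS.kerFun H (-1) (WithLp.toLp 2 ((w (-1)).fst, (0 : U)))) =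
      inner ℂ (w (-1)).fst (w (-1)).fst := by
    rw [RKHS.inner_kerFun, inner_eq_add]
    simp
  rw [projNegOne_apply, @norm_sub_sq ℂ, h1, h2, inner_self_eq_norm_sq]
  ring

/-- The operators of the canonical colligation on the model subspace: the shift of two-sided
sequences followed by the removal of the coefficient that leaves its half-line. -/
theorem exists_modelOperators (hH : RKHS.kernel H = laurentKernel (opCoeff S)) :
    ∃ (A A' : modelSubmodule H →L[ℂ] modelSubmodule H) (B : U →L[ℂ] modelSubmodule H),
      (∀ x y, inner ℂ (A x) y = inner ℂ x (A' y)) ∧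
      (∀ u x, inner ℂ (B u) x = inner ℂ u ((x : H) (-1)).snd) ∧
      (∀ x u, ‖A x + B u‖ ^ 2 + ‖((x : H) 0).fst + opCoeff S 0 u‖ ^ 2 = ‖x‖ ^ 2 + ‖u‖ ^ 2) ∧
      (∀ x' y, ∃ x u, A x + B u = x' ∧ ((x : H) 0).fst + opCoeff S 0 u = y) ∧
      (∀ x (n : ℕ), ((A x : H) n).fst = ((x : H) (n + 1 : ℕ)).fst) ∧
      (∀ x (n : ℕ), ((A x : H) (Int.negSucc n)).snd =
        (if 1 ≤ n then ((x : H) (Int.negSucc (n - 1))).snd else 0) -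
          adjoint (opCoeff S n) ((x : H) 0).fst) ∧
      (∀ x (n : ℕ), ((A' x : H) n).fst =
        (if 1 ≤ n then ((x : H) (n - 1 : ℕ)).fst else 0) - opCoeff S n ((x : H) (-1)).snd) ∧
      (∀ x (n : ℕ), ((A' x : H) (Int.negSucc n)).snd = ((x : H) (Int.negSucc (n + 1))).snd) ∧
      (∀ u (n : ℕ), ((B u : H) n).fst = opCoeff S (n + 1) u) ∧
      (∀ u (n : ℕ), ((B u : H) (Int.negSucc n)).snd =
        (if n = 0 then u else 0) - adjoint (opCoeff S n) (opCoeff S 0 u)) := by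
  obtain ⟨W, hW, hW'⟩ := exists_bilateralShift hH
  set s := opCoeff S with hs
  have hM : ∀ x : modelSubmodule H, ∀ n : ℤ, (n < 0 → ((x : H) n).fst = 0) ∧
      (0 ≤ n → ((x : H) n).snd = 0) := by
    intro x n
    cases n with
    | ofNat n => exact ⟨fun h => absurd h (by simp), fun _ => (x.2 n).2⟩
    | negSucc n => exact ⟨fun _ => (x.2 n).1, fun h => absurd h (by simp)⟩
  have hcoord : ∀ w : H, (∀ n : ℤ, n < 0 → (w n).fst = 0) → (∀ n : ℤ, 0 ≤ n → (w n).snd = 0) →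
      w ∈ modelSubmodule H := fun w h1 h2 n => ⟨h1 _ (by simp), h2 _ (by simp)⟩
  -- coordinates of the three operators before restriction
  have hEf : ∀ (w : H) (n : ℤ), (projNegOne H w n).fst =
      (w n).fst - if n = -1 then (w (-1)).fst else 0 := fun w n => by
    rw [projNegOne_apply, RKHS.coe_sub, Pi.sub_apply, WithLp.sub_fst, kerFun_fst hH]
    simp
  have hEs : ∀ (w : H) (n : ℤ), (projNegOne H w n).snd =
      (w n).snd - adjoint (extCoeff s (-1 - n)) (w (-1)).fst := fun w n => by
    rw [projNegOne_apply, RKHS.coe_sub, Pi.sub_apply, WithLp.sub_snd, kerFun_snd hH]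
    simp
  have hZf : ∀ (w : H) (n : ℤ), (projZero H w n).fst =
      (w n).fst - extCoeff s n (w 0).snd := fun w n => by
    rw [projZero_apply, RKHS.coe_sub, Pi.sub_apply, WithLp.sub_fst, kerFun_fst hH]
    simp
  have hZs : ∀ (w : H) (n : ℤ), (projZero H w n).snd =
      (w n).snd - if n = 0 then (w 0).snd else 0 := fun w n => by
    rw [projZero_apply, RKHS.coe_sub, Pi.sub_apply, WithLp.sub_snd, kerFun_snd hH]
    simp
  have hkf : ∀ (u : U) (n : ℤ), (RKHS.kerFun H (-1) (inSnd Y U u) n).fst = extCoeff s (n + 1) u :=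
    fun u n => by rw [kerFun_fst hH]; simp
  have hks : ∀ (u : U) (n : ℤ), (RKHS.kerFun H (-1) (inSnd Y U u) n).snd =
      if n = -1 then u else 0 := fun u n => by rw [kerFun_snd hH]; simp
  let A : modelSubmodule H →L[ℂ] modelSubmodule H :=
    (projNegOne H ∘L W.symm.toContinuousLinearEquiv.toContinuousLinearMap ∘L
      (modelSubmodule H).subtypeL).codRestrict _ fun x => by
    refine hcoord _ (fun n hn => ?_) fun n hn => ?_
    · change (projNegOne H (W.symm x) n).fst = 0
      rw [hEf, hW', hW']
      split_ifs with h
      · rw [h, sub_self]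
      · rw [sub_zero]; exact (hM x _).1 (by omega)
    · change (projNegOne H (W.symm x) n).snd = 0
      rw [hEs, hW', extCoeff_of_neg _ (by omega), (hM x _).2 (by omega)]
      simp
  have hA : ∀ x : modelSubmodule H, (A x : H) = projNegOne H (W.symm x) := fun x => rfl
  let A' : modelSubmodule H →L[ℂ] modelSubmodule H :=
    (projZero H ∘L W.toContinuousLinearEquiv.toContinuousLinearMap ∘L
      (modelSubmodule H).subtypeL).codRestrict _ fun x => by
    refine hcoord _ (fun n hn => ?_) fun n hn => ?_
    · change (projZero H (W x) n).fst = 0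
      rw [hZf, hW, extCoeff_of_neg _ hn, (hM x _).1 (by omega)]
      simp
    · change (projZero H (W x) n).snd = 0
      rw [hZs, hW, hW]
      split_ifs with h
      · rw [h, sub_self]
      · rw [sub_zero]; exact (hM x _).2 (by omega)
  have hA' : ∀ x : modelSubmodule H, (A' x : H) = projZero H (W x) := fun x => rfl
  let B : U →L[ℂ] modelSubmodule H :=
    (projNegOne H ∘L RKHS.kerFun H (-1) ∘L inSnd Y U).codRestrict _ fun u => by
    refine hcoord _ (fun n hn => ?_) fun n hn => ?_
    · change (projNegOne H (RKHS.kerFun H (-1) (inSnd Y U u)) n).fst = 0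
      rw [hEf, hkf, hkf]
      split_ifs with h
      · rw [h, sub_self]
      · rw [sub_zero, extCoeff_of_neg _ (by omega)]; rfl
    · change (projNegOne H (RKHS.kerFun H (-1) (inSnd Y U u)) n).snd = 0
      rw [hEs, hks, if_neg (by omega), extCoeff_of_neg _ (by omega)]
      simp
  have hB : ∀ u, (B u : H) = projNegOne H (RKHS.kerFun H (-1) (inSnd Y U u)) := fun u => rfl
  refine ⟨A, A', B, fun x y => ?_, fun u x => ?_, fun x u => ?_, fun x' y => ?_, fun x n => ?_,
    fun x n => ?_, fun x n => ?_, fun x n => ?_, fun u n => ?_, fun u n => ?_⟩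
  · rw [Submodule.coe_inner, Submodule.coe_inner, hA, hA', projNegOne_apply, projZero_apply,
      inner_sub_left, inner_sub_right, RKHS.kerFun_inner, RKHS.inner_kerFun, inner_eq_add,
      inner_eq_add, (hM y (-1)).1 (by omega), (hM x 0).2 le_rfl]
    simp only [WithLp.toLp_fst, WithLp.toLp_snd, inner_zero_right, inner_zero_left, add_zero,
      sub_zero]
    rw [← LinearIsometryEquiv.inner_map_map W (W.symm x), W.apply_symm_apply]
  · rw [Submodule.coe_inner, hB, projNegOne_apply, inner_sub_left, RKHS.kerFun_inner,
      RKHS.kerFun_inner, inner_eq_add, inner_eq_add, (hM x (-1)).1 (by omega)]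
    simp
  · have h1 : ((A x + B u : modelSubmodule H) : H) =
        projNegOne H (W.symm x + RKHS.kerFun H (-1) (inSnd Y U u)) := by
      rw [Submodule.coe_add, hA, hB, map_add]
    have h2 : ((W.symm x + RKHS.kerFun H (-1) (inSnd Y U u) : H) (-1)).fst =
        ((x : H) 0).fst + s 0 u := by
      rw [RKHS.coe_add, Pi.add_apply, WithLp.add_fst, hW', hkf, neg_add_cancel,
        extCoeff_zero]
    have h3 : ‖RKHS.kerFun H (-1) (inSnd Y U u)‖ ^ 2 = ‖u‖ ^ 2 := by
      rw [← inner_self_eq_norm_sq (𝕜 := ℂ), RKHS.kerFun_inner, inner_eq_add, hks]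
      simp [← Complex.ofReal_pow]
    have h4 : inner ℂ (W.symm x) (RKHS.kerFun H (-1) (inSnd Y U u)) = 0 := by
      rw [RKHS.inner_kerFun, inner_eq_add, hW', neg_add_cancel, (hM x 0).2 le_rfl]
      simp
    rw [Submodule.coe_norm, h1, norm_projNegOne_sq hH, h2, @norm_add_sq ℂ, h3, h4,
      LinearIsometryEquiv.norm_map, Submodule.coe_norm]
    simp
  · -- the preimage is read off from `w = x' + k₋₁ (y, 0)`
    set w : H := x' + RKHS.kerFun H (-1) (inFst Y U y) with hw
    have hwf : ∀ n : ℤ, (w n).fst = ((x' : H) n).fst + if n = -1 then y else 0 := fun n => by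
      rw [hw, RKHS.coe_add, Pi.add_apply, WithLp.add_fst, kerFun_fst hH]
      simp
    have hws : ∀ n : ℤ, 0 ≤ n → (w n).snd = 0 := fun n hn => by
      rw [hw, RKHS.coe_add, Pi.add_apply, WithLp.add_snd, kerFun_snd hH, (hM x' n).2 hn,
        extCoeff_of_neg _ (by omega)]
      simp
    set u := (w (-1)).snd with hu
    set x₀ : H := W (w - RKHS.kerFun H (-1) (inSnd Y U u)) with hx₀
    have hf : ∀ n, (x₀ n).fst = (w (n - 1)).fst - extCoeff s n u := fun n => by
      rw [hx₀, hW, RKHS.coe_sub, Pi.sub_apply, WithLp.sub_fst, hkf, sub_add_cancel]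
    have hx₀M : x₀ ∈ modelSubmodule H := by
      refine hcoord _ (fun n hn => ?_) fun n hn => ?_
      · rw [hf, hwf, (hM x' _).1 (by omega), if_neg (by omega), extCoeff_of_neg _ hn]
        simp
      · rw [hx₀, hW, RKHS.coe_sub, Pi.sub_apply, WithLp.sub_snd, hks]
        split_ifs with h
        · rw [h, ← hu, sub_self]
        · rw [hws _ (by omega), sub_zero]
    refine ⟨⟨x₀, hx₀M⟩, u, Subtype.ext ?_, ?_⟩
    · rw [Submodule.coe_add, hA, hB, ← map_add]
      change projNegOne H (W.symm x₀ + _) = x'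
      rw [hx₀, W.symm_apply_apply, sub_add_cancel,
        projNegOne_apply, hwf, (hM x' (-1)).1 (by omega), hw]
      simp
    · change (x₀ 0).fst + s 0 u = y
      rw [hf, hwf, (hM x' _).1 (by omega), extCoeff_zero]
      simp
  · rw [hA, hEf, hW', if_neg (by omega), sub_zero]
    simp
  · rw [hA, hEs, hW', hW', show (-1 : ℤ) - Int.negSucc n = n by omega, extCoeff_natCast,
      neg_add_cancel]
    congr 1
    split_ifs with h
    · rw [show Int.negSucc n + 1 = Int.negSucc (n - 1) by omega]
    · exact (hM x _).2 (by omega)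
  · rw [hA', hZf, hW, hW, extCoeff_natCast, zero_sub]
    congr 1
    split_ifs with h
    · rw [Nat.cast_sub h, Nat.cast_one]
    · exact (hM x _).1 (by omega)
  · rw [hA', hZs, hW, if_neg (by omega), sub_zero,
      show Int.negSucc n - 1 = Int.negSucc (n + 1) by omega]
  · rw [hB, hEf, hkf, if_neg (by omega), sub_zero, ← Nat.cast_one, ← Nat.cast_add,
      extCoeff_natCast]
  · rw [hB, hEs, hks, hkf, show (-1 : ℤ) - Int.negSucc n = n by omega, extCoeff_natCast,
      neg_add_cancel, extCoeff_zero]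
    congr 1
    by_cases h : n = 0
    · simp [h]
    · rw [if_neg (by omega), if_neg h]

end ModelOperators

/-! ### The canonical colligation on `D(S)` -/

section Functions

variable {E : Type*} [NormedAddCommGroup E] [InnerProductSpace ℂ E]

lemma HasTaylor.fun_unique {a : ℕ → E} {f g : 𝔻 → E} (hf : HasTaylor a f) (hg : HasTaylor a g) :
    f = g := funext fun z => (hf z).unique (hg z)

lemma smul_backwardShift (f : 𝔻 → E) (z : 𝔻) : (z : ℂ) • backwardShift f z = f z - f 0 := by
  by_cases hz : z = 0
  · simp [hz]
  · have hz' : (z : ℂ) ≠ 0 := by simpa using hz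
    simp [backwardShift, hz, smul_smul]

variable {U : Type u} [NormedAddCommGroup U] [InnerProductSpace ℂ U] [CompleteSpace U]
  {Y : Type v} [NormedAddCommGroup Y] [InnerProductSpace ℂ Y] [CompleteSpace Y]
  {S : ℂ → U →L[ℂ] Y}

omit [CompleteSpace U] in
lemma IsSchur.hasTaylor_apply (hS : IsSchur S) (x : U) :
    HasTaylor (fun n => opCoeff S n x) fun z => S z x := fun z => by
  simpa using (ContinuousLinearMap.apply ℂ Y x).hasSum (hS.hasSum z)

lemma IsSchur.hasTaylor_tilde (hS : IsSchur S) (y : Y) :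
    HasTaylor (fun n => adjoint (opCoeff S n) y) fun z => tilde S z y := fun z => by
  have h1 := (hS.hasSum (star z)).map (adjoint : (U →L[ℂ] Y) ≃ₗᵢ⋆[ℂ] (Y →L[ℂ] U))
    (LinearIsometryEquiv.continuous _)
  have h2 := (ContinuousLinearMap.apply ℂ U y).hasSum h1
  simpa [Function.comp_def, tilde, LinearIsometryEquiv.map_smulₛₗ, ← map_pow] using h2

omit [CompleteSpace U] [CompleteSpace Y] in
lemma opCoeff_zero (S : ℂ → U →L[ℂ] Y) : opCoeff S 0 = S 0 := by simp [opCoeff]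

omit [CompleteSpace U] [CompleteSpace Y] in
lemma opCoeff_one (S : ℂ → U →L[ℂ] Y) : opCoeff S 1 = deriv S 0 := by simp [opCoeff]

omit [CompleteSpace U] in
lemma IsSchur.hasTaylor_dslope (hS : IsSchur S) (x : U) :
    HasTaylor (fun n => opCoeff S (n + 1) x) fun z : 𝔻 => dslope S 0 z x := by
  convert (hS.hasTaylor_apply x).backwardShift using 1
  funext z
  by_cases hz : z = 0
  · subst hz
    simp [backwardShift, (hS.hasTaylor_apply x).taylorCoeff_eq, opCoeff_one]
  · have hz' : (z : ℂ) ≠ 0 := by simpa using hz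
    rw [dslope_of_ne _ hz', slope_def_module]
    simp [backwardShift, hz]

lemma IsSchur.hasTaylor_kS_tilde (hS : IsSchur S) (x : U) :
    HasTaylor (fun n => (if n = 0 then x else 0) - adjoint (opCoeff S n) (opCoeff S 0 x))
      fun z : 𝔻 => kS (tilde S) z 0 x := by
  have h1 := (hasTaylor_sum_range (fun _ => x) 1).sub (hS.hasTaylor_tilde (opCoeff S 0 x))
  convert h1 using 1
  · funext n
    simp
  · funext z
    simp [kS, tilde, opCoeff_zero]

end Functions

section Canonical

variable {U : Type u} [NormedAddCommGroup U] [InnerProductSpace ℂ U] [CompleteSpace U]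
  {Y : Type v} [NormedAddCommGroup Y] [InnerProductSpace ℂ Y] [CompleteSpace Y]
  {S : ℂ → U →L[ℂ] Y}

section

variable [NormedAddCommGroup (DSpace S)] [InnerProductSpace ℂ (DSpace S)]
  [CompleteSpace (DSpace S)] [RKHS ℂ (DSpace S) 𝔻 (WithLp 2 (Y × U))]

omit [CompleteSpace U] [CompleteSpace Y] [CompleteSpace (DSpace S)] in
lemma IsDStructure.coe_eq' (hD : IsDStructure S) (F : DSpace S) : ⇑F = F.toFun := hD.coe_eq F

variable {A A' : DSpace S →L[ℂ] DSpace S} {B : U →L[ℂ] DSpace S} {C : DSpace S →L[ℂ] Y}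

/-- The first component of an element is recovered from the state operators. -/
lemma apply_res_eq_fst (hD : IsDStructure S) (hA1 : ‖A‖ ≤ 1)
    (hA : ∀ F, (A F).toFun = hatR S F.toFun) (hC : ∀ F, C F = (F.toFun 0).fst) (F : DSpace S)
    (z : 𝔻) : C (res A z F) = (F.toFun z).fst := by
  set G := res A z F with hG
  have h1 : F = G - (z : ℂ) • A G := (sub_res_apply hA1 z F).symm
  have h2 : (F.toFun z).fst = (G.toFun z).fst -
      (z : ℂ) • backwardShift (fun x => (G.toFun x).fst) z := by
    rw [h1, ← hD.coe_eq', RKHS.coe_sub, RKHS.coe_smul, hD.coe_eq', hD.coe_eq', hA]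
    rfl
  rw [hC, h2, smul_backwardShift, sub_sub_cancel]

omit [CompleteSpace U] [CompleteSpace Y] in
/-- The second component of an element is recovered from the adjoint state operators. -/
lemma apply_res_eq_snd (hD : IsDStructure S) {B' : DSpace S →L[ℂ] U} (hA1 : ‖A'‖ ≤ 1)
    (hA : ∀ F, (A' F).toFun = hatRAdj S F.toFun) (hB : ∀ F, B' F = (F.toFun 0).snd) (F : DSpace S)
    (z : 𝔻) : B' (res A' z F) = (F.toFun z).snd := by
  set G := res A' z F with hG
  have h1 : F = G - (z : ℂ) • A' G := (sub_res_apply hA1 z F).symm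
  have h2 : (F.toFun z).snd = (G.toFun z).snd -
      (z : ℂ) • backwardShift (fun x => (G.toFun x).snd) z := by
    rw [h1, ← hD.coe_eq', RKHS.coe_sub, RKHS.coe_smul, hD.coe_eq', hD.coe_eq', hA]
    rfl
  rw [hB, h2, smul_backwardShift, sub_sub_cancel]

/-- A unitary colligation whose state operator is `R̂₀` realizes `S`. -/
lemma isUnitaryRealization_of_hatR (hD : IsDStructure S)
    (hu : IsUnitaryOp (blockOp A B C (S 0)))
    (hA : ∀ F, (A F).toFun = hatR S F.toFun) (hB : ∀ x, (B x).toFun = hatB S x)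
    (hC : ∀ F, C F = (F.toFun 0).fst) : IsUnitaryRealization A B C (S 0) S := by
  have hA1 : ‖A‖ ≤ 1 := (IsUnitaryRealization.mk (S := fun z => S 0 + z • (C ∘L res A z ∘L B))
    hu fun z => rfl).norm_le_one
  refine ⟨hu, fun z => ContinuousLinearMap.ext fun x => ?_⟩
  simp only [add_apply, smul_apply, comp_apply]
  rw [apply_res_eq_fst hD hA1 hA hC, hB]
  change S z x = S 0 x + (z : ℂ) • dslope S 0 z x
  by_cases hz : z = 0
  · simp [hz]
  · have hz' : (z : ℂ) ≠ 0 := by simpa using hz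
    rw [dslope_of_ne _ hz', slope_def_module]
    simp [smul_smul, mul_inv_cancel₀ hz']

lemma kernel_eq_kHat (hD : IsDStructure S) (h : IsUnitaryRealization A B C (S 0) S)
    (hA : ∀ F, (A F).toFun = hatR S F.toFun) (hA' : ∀ F, (adjoint A F).toFun = hatRAdj S F.toFun)
    (hC : ∀ F, C F = (F.toFun 0).fst) (hB : ∀ F, adjoint B F = (F.toFun 0).snd) :
    RKHS.kernel (DSpace S) = kHat S := by
  have h1 : ∀ z : 𝔻, adjoint (RKHS.kerFun (DSpace S) z) = stateEval A B C z := fun z => by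
    refine ContinuousLinearMap.ext fun F => ?_
    rw [RKHS.adjoint_kerFun, hD.coe_eq']
    refine withLp_ext ?_ ?_
    · rw [stateEval_fst, apply_res_eq_fst hD h.norm_le_one hA hC]
    · rw [stateEval_snd, apply_res_eq_snd hD h.dual.norm_le_one hA' hB]
  have h2 : ∀ z w, RKHS.kernel (DSpace S) z w = kHat S z w := fun z w => by
    rw [← h.stateEval_comp_adjoint z w, RKHS.kernel_apply, ← h1, ← h1, adjoint_adjoint]
  exact Matrix.ext h2

end

section

variable {H : Type*} [NormedAddCommGroup H] [InnerProductSpace ℂ H] [CompleteSpace H]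
  [RKHS ℂ H ℤ (WithLp 2 (Y × U))]

lemma evalFun_eq_hatR (hS : IsSchur S) (hH : RKHS.kernel H = laurentKernel (opCoeff S)) {x y : H}
    (h1 : ∀ n : ℕ, (y n).fst = (x (n + 1 : ℕ)).fst)
    (h2 : ∀ n : ℕ, (y (Int.negSucc n)).snd =
      (if 1 ≤ n then (x (Int.negSucc (n - 1))).snd else 0) - adjoint (opCoeff S n) (x 0).fst) :
    evalFun y = hatR S (evalFun x) := by
  have hx := hasTaylor_evalFun_fst hH x
  have hx' := hasTaylor_evalFun_snd hH x
  have e1 := (hasTaylor_evalFun_fst hH y).fun_unique (by simpa only [h1] using hx.backwardShift)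
  have h0 : (x 0).fst = (evalFun x 0).fst := hx.apply_zero.symm
  have e2 := (hasTaylor_evalFun_snd hH y).fun_unique (by
    simp only [h2]
    exact (hx'.pow_smul 1).sub (hS.hasTaylor_tilde (x 0).fst))
  funext z
  refine withLp_ext (congrFun e1 z) ?_
  have := congrFun e2 z
  rw [h0] at this
  simpa [hatR] using this

lemma evalFun_eq_hatRAdj (hS : IsSchur S) (hH : RKHS.kernel H = laurentKernel (opCoeff S))
    {x y : H}
    (h1 : ∀ n : ℕ, (y n).fst =
      (if 1 ≤ n then (x (n - 1 : ℕ)).fst else 0) - opCoeff S n (x (-1)).snd)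
    (h2 : ∀ n : ℕ, (y (Int.negSucc n)).snd = (x (Int.negSucc (n + 1))).snd) :
    evalFun y = hatRAdj S (evalFun x) := by
  have hx := hasTaylor_evalFun_fst hH x
  have hx' := hasTaylor_evalFun_snd hH x
  have e1 := (hasTaylor_evalFun_snd hH y).fun_unique (by simpa only [h2] using hx'.backwardShift)
  have h0 : (x (-1)).snd = (evalFun x 0).snd := hx'.apply_zero.symm
  have e2 := (hasTaylor_evalFun_fst hH y).fun_unique (by
    simp only [h1]
    exact (hx.pow_smul 1).sub (hS.hasTaylor_apply (x (-1)).snd))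
  funext z
  refine withLp_ext ?_ (congrFun e1 z)
  have := congrFun e2 z
  rw [h0] at this
  simpa [hatRAdj] using this

end

/-- The canonical model, built from any realization of the Laurent space. -/
lemma IsSchur.exists_canonicalModel_of_kernel {H : Type*} [NormedAddCommGroup H]
    [InnerProductSpace ℂ H] [CompleteSpace H] [RKHS ℂ H ℤ (WithLp 2 (Y × U))] (hS : IsSchur S)
    (hH : RKHS.kernel H = laurentKernel (opCoeff S)) :
    ∃ (_ : NormedAddCommGroup (DSpace S)) (_ : InnerProductSpace ℂ (DSpace S))
      (_ : CompleteSpace (DSpace S)) (_ : RKHS ℂ (DSpace S) 𝔻 (WithLp 2 (Y × U))),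
      IsDStructure S ∧ RKHS.kernel (DSpace S) = kHat S ∧
      ∃ (A : DSpace S →L[ℂ] DSpace S) (B : U →L[ℂ] DSpace S) (C : DSpace S →L[ℂ] Y),
        (∀ F, (A F).toFun = hatR S F.toFun) ∧ (∀ F, (adjoint A F).toFun = hatRAdj S F.toFun) ∧
        (∀ x, (B x).toFun = hatB S x) ∧ (∀ F, C F = (F.toFun 0).fst) ∧
        (∀ F, adjoint B F = (F.toFun 0).snd) ∧ IsUnitaryRealization A B C (S 0) S := by
  set E : DSpace S ≃ modelSubmodule H := (Equiv.ofBijective _ (bijective_toDSpace hS hH)).symm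
  have hE : ∀ F : DSpace S, F.toFun = evalFun (E F : H) := fun F => by
    have : toDSpace hS hH (E F) = F :=
      (Equiv.ofBijective _ (bijective_toDSpace hS hH)).apply_symm_apply F
    exact (congrArg DSpace.toFun this).symm
  choose ev hev using fun z => exists_evalFun_eq hH z
  obtain ⟨_, _, _, _, hD, L, hL⟩ := exists_structure E
    (fun z => ev z ∘L (modelSubmodule H).subtypeL) (fun z F => by rw [hE F]; exact hev z _)
    fun F => by
      have e := hE F
      have h1 := hasTaylor_evalFun_fst hH (E F : H)
      have h2 := hasTaylor_evalFun_snd hH (E F : H)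
      rw [← e] at h1 h2
      exact hS.tendsto_dSeq hH h1 h2 (coe_eq_pairSeq (E F).2)
  have hL' : ∀ F : DSpace S, F.toFun = evalFun (L F : H) := fun F => by rw [hL]; exact hE F
  have hLs : ∀ x : modelSubmodule H, (L.symm x).toFun = evalFun (x : H) := fun x => by
    rw [hL', L.apply_symm_apply]
  have hf0 : ∀ F : DSpace S, (F.toFun 0).fst = ((L F : H) 0).fst := fun F => by
    rw [hL']; exact (hasTaylor_evalFun_fst hH (L F : H)).apply_zero
  have hg0 : ∀ F : DSpace S, (F.toFun 0).snd = ((L F : H) (-1)).snd := fun F => by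
    rw [hL']; exact (hasTaylor_evalFun_snd hH (L F : H)).apply_zero
  obtain ⟨A₀, A₀', B₀, hadj, hB₀adj, hnorm, hsurj, hA1, hA2, hA'1, hA'2, hB1, hB2⟩ :=
    exists_modelOperators hH
  let A : DSpace S →L[ℂ] DSpace S := L.symm.toContinuousLinearEquiv.toContinuousLinearMap ∘L A₀ ∘L
    L.toContinuousLinearEquiv.toContinuousLinearMap
  let A' : DSpace S →L[ℂ] DSpace S := L.symm.toContinuousLinearEquiv.toContinuousLinearMap ∘L A₀' ∘L
    L.toContinuousLinearEquiv.toContinuousLinearMap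
  let B : U →L[ℂ] DSpace S := L.symm.toContinuousLinearEquiv.toContinuousLinearMap ∘L B₀
  have hA : ∀ F, A F = L.symm (A₀ (L F)) := fun F => rfl
  have hA' : ∀ F, A' F = L.symm (A₀' (L F)) := fun F => rfl
  have hB : ∀ u, B u = L.symm (B₀ u) := fun F => rfl
  let C : DSpace S →L[ℂ] Y := WithLp.fstL 2 ℂ Y U ∘L adjoint (RKHS.kerFun (DSpace S) (0 : 𝔻))
  have hC : ∀ F, C F = (F.toFun 0).fst := fun F => by
    rw [← hD.coe_eq', ← RKHS.adjoint_kerFun]; rfl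
  have hAdj : adjoint A = A' := by
    refine ((ContinuousLinearMap.eq_adjoint_iff A' A).2 fun F G => ?_).symm
    rw [hA, hA', ← LinearIsometryEquiv.inner_map_map L, ← LinearIsometryEquiv.inner_map_map L F,
      L.apply_symm_apply, L.apply_symm_apply, ← inner_conj_symm, ← hadj, inner_conj_symm]
  have hfA : ∀ F, (A F).toFun = hatR S F.toFun := fun F => by
    rw [hA, hLs, hL' F]
    exact evalFun_eq_hatR hS hH (hA1 (L F)) (hA2 (L F))
  have hfA' : ∀ F, (adjoint A F).toFun = hatRAdj S F.toFun := fun F => by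
    rw [hAdj, hA', hLs, hL' F]
    exact evalFun_eq_hatRAdj hS hH (hA'1 (L F)) (hA'2 (L F))
  have hfB : ∀ x, (B x).toFun = hatB S x := fun x => by
    rw [hB, hLs]
    have e1 := (hasTaylor_evalFun_fst hH (B₀ x : H)).fun_unique
      (by simpa only [hB1] using hS.hasTaylor_dslope x)
    have e2 := (hasTaylor_evalFun_snd hH (B₀ x : H)).fun_unique
      (by simpa only [hB2] using hS.hasTaylor_kS_tilde x)
    exact funext fun z => withLp_ext (congrFun e1 z) (congrFun e2 z)
  have hBadj : ∀ F, adjoint B F = (F.toFun 0).snd := fun F => by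
    refine ext_inner_left ℂ fun u => ?_
    rw [adjoint_inner_right, hB, ← LinearIsometryEquiv.inner_map_map L, L.apply_symm_apply, hB₀adj,
      hg0]
  have hu : IsUnitaryOp (blockOp A B C (S 0)) := by
    refine isUnitaryOp_of_norm_eq (fun p => ?_) fun q => ?_
    · have h1 := hnorm (L p.fst) p.snd
      have h2 : L (A p.fst + B p.snd) = A₀ (L p.fst) + B₀ p.snd := by
        rw [map_add, hA, hB, L.apply_symm_apply, L.apply_symm_apply]
      rw [← h2, L.norm_map, L.norm_map, ← hf0, ← hC, opCoeff_zero] at h1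
      rw [← sq_eq_sq₀ (norm_nonneg _) (norm_nonneg _), WithLp.prod_norm_sq_eq_of_L2,
        WithLp.prod_norm_sq_eq_of_L2, blockOp_fst, blockOp_snd, h1]
    · obtain ⟨x, u, h1, h2⟩ := hsurj (L q.fst) q.snd
      refine ⟨WithLp.toLp 2 (L.symm x, u), withLp_ext ?_ ?_⟩
      · rw [blockOp_fst, WithLp.toLp_fst, WithLp.toLp_snd, hA, hB, L.apply_symm_apply, ← map_add,
          h1, L.symm_apply_apply]
      · rw [blockOp_snd, WithLp.toLp_fst, WithLp.toLp_snd, hC, hf0, L.apply_symm_apply,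
          ← opCoeff_zero S, h2]
  have hreal := isUnitaryRealization_of_hatR hD hu hfA hfB hC
  exact ⟨inferInstance, inferInstance, inferInstance, inferInstance, hD,
    kernel_eq_kHat hD hreal hfA hfA' hC hBadj, A, B, C, hfA, hfA', hfB, hC, hBadj, hreal⟩

/-- The space `D(S)` is a reproducing kernel Hilbert space, and `S` is the transfer function of its
canonical unitary colligation. -/
theorem IsSchur.exists_canonicalModel (hS : IsSchur S) :
    ∃ (_ : NormedAddCommGroup (DSpace S)) (_ : InnerProductSpace ℂ (DSpace S))
      (_ : CompleteSpace (DSpace S)) (_ : RKHS ℂ (DSpace S) 𝔻 (WithLp 2 (Y × U))),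
      IsDStructure S ∧ RKHS.kernel (DSpace S) = kHat S ∧
      ∃ (A : DSpace S →L[ℂ] DSpace S) (B : U →L[ℂ] DSpace S) (C : DSpace S →L[ℂ] Y),
        (∀ F, (A F).toFun = hatR S F.toFun) ∧ (∀ F, (adjoint A F).toFun = hatRAdj S F.toFun) ∧
        (∀ x, (B x).toFun = hatB S x) ∧ (∀ F, C F = (F.toFun 0).fst) ∧
        (∀ F, adjoint B F = (F.toFun 0).snd) ∧ IsUnitaryRealization A B C (S 0) S := by
  have : Fact (laurentKernel (opCoeff S)).PosSemidef :=
    ⟨posSemidef_laurentKernel hS.isToeplitzContraction⟩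
  exact hS.exists_canonicalModel_of_kernel (RKHS.OfKernel.kernel_ofKernel
    (K := laurentKernel (opCoeff S)))

end Canonical

/-! ### Completely non-unitary contractions and their models -/

section Cnu

variable {X : Type*} [NormedAddCommGroup X] [InnerProductSpace ℂ X] [CompleteSpace X]

lemma isCNUContraction_iff {T : X →L[ℂ] X} : IsCNUContraction T ↔ ‖T‖ ≤ 1 ∧
    ∀ x, (∀ n, ‖(T ^ n) x‖ = ‖x‖) → (∀ n, ‖(adjoint T ^ n) x‖ = ‖x‖) → x = 0 := by
  refine and_congr_right fun _ => ⟨fun h x h1 h2 => ?_, fun h => ?_⟩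
  · have : x ∈ ({0} : Set X) := by
      rw [← h]
      exact ⟨Set.mem_iInter.2 h2, Set.mem_iInter.2 h1⟩
    exact this
  · refine Set.eq_singleton_iff_unique_mem.2 ⟨by simp, fun x hx => ?_⟩
    exact h x (fun n => Set.mem_iInter.1 hx.2 n) fun n => Set.mem_iInter.1 hx.1 n

lemma IsCNUContraction.of_intertwining {X' : Type*} [NormedAddCommGroup X']
    [InnerProductSpace ℂ X'] [CompleteSpace X'] {T : X →L[ℂ] X} {T' : X' →L[ℂ] X'}
    (hT' : IsCNUContraction T') (W : X ≃ₗᵢ[ℂ] X') (h : ∀ x, W (T x) = T' (W x)) :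
    IsCNUContraction T := by
  rw [isCNUContraction_iff] at hT' ⊢
  have h' : ∀ x, W (adjoint T x) = adjoint T' (W x) := fun x => by
    refine ext_inner_right ℂ fun y => ?_
    obtain ⟨y, rfl⟩ := W.surjective y
    rw [adjoint_inner_left, ← h, W.inner_map_map, W.inner_map_map, adjoint_inner_left]
  have hpow : ∀ {R : X →L[ℂ] X} {R' : X' →L[ℂ] X'}, (∀ x, W (R x) = R' (W x)) →
      ∀ n x, W ((R ^ n) x) = (R' ^ n) (W x) := by
    intro R R' hR n
    induction n with
    | zero => simp
    | succ n ih => intro x; rw [pow_succ, pow_succ, mul_apply_eq_comp, mul_apply_eq_comp, ih, hR]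
  refine ⟨ContinuousLinearMap.opNorm_le_bound _ zero_le_one fun x => ?_, fun x h1 h2 => ?_⟩
  · rw [← W.norm_map, h, ← W.norm_map x]
    exact T'.le_of_opNorm_le hT'.1 _
  · refine W.map_eq_zero_iff.1 (hT'.2 _ (fun n => ?_) fun n => ?_)
    · rw [← hpow h, W.norm_map, W.norm_map, h1]
    · rw [← hpow h', W.norm_map, W.norm_map, h2]

end Cnu

namespace IsUnitaryRealization

variable {U : Type*} [NormedAddCommGroup U] [InnerProductSpace ℂ U] [CompleteSpace U]
  {Y : Type*} [NormedAddCommGroup Y] [InnerProductSpace ℂ Y] [CompleteSpace Y]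
  {X : Type*} [NormedAddCommGroup X] [InnerProductSpace ℂ X] [CompleteSpace X]
  {A : X →L[ℂ] X} {B : U →L[ℂ] X} {C : X →L[ℂ] Y} {D : U →L[ℂ] Y} {S : ℂ → U →L[ℂ] Y}

lemma norm_pow_eq_iff (h : IsUnitaryRealization A B C D S) (x : X) :
    (∀ n, ‖(A ^ n) x‖ = ‖x‖) ↔ ∀ n, C ((A ^ n) x) = 0 := by
  have key : ∀ n, ‖(A ^ (n + 1)) x‖ ^ 2 + ‖C ((A ^ n) x)‖ ^ 2 = ‖(A ^ n) x‖ ^ 2 := fun n => by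
    rw [pow_succ' A n, mul_apply_eq_comp, h.norm_sq_add]
  refine ⟨fun h1 n => ?_, fun h1 n => ?_⟩
  · have := key n
    rw [h1, h1, add_eq_left] at this
    simpa only [sq_eq_zero_iff, norm_eq_zero] using this
  · induction n with
    | zero => simp
    | succ n ih =>
      have := key n
      rw [h1, norm_zero, zero_pow two_ne_zero, add_zero, ih] at this
      exact (sq_eq_sq₀ (norm_nonneg _) (norm_nonneg _)).1 this

/-- The states on which the colligation and its adjoint stay isometric forever are those that
produce the zero pair of functions. -/
lemma norm_pow_eq_iff_stateEval (h : IsUnitaryRealization A B C D S) (x : X) :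
    ((∀ n, ‖(A ^ n) x‖ = ‖x‖) ∧ ∀ n, ‖(adjoint A ^ n) x‖ = ‖x‖) ↔
      ∀ z : 𝔻, stateEval A B C z x = 0 := by
  rw [h.norm_pow_eq_iff, h.dual.norm_pow_eq_iff]
  have e1 := h.hasTaylor_stateEval_fst x
  have e2 := h.hasTaylor_stateEval_snd x
  refine ⟨fun ⟨h1, h2⟩ z => withLp_ext ?_ ?_, fun h1 => ⟨fun n => ?_, fun n => ?_⟩⟩
  · refine (e1 z).unique ?_
    simp only [h1, smul_zero]
    exact hasSum_zero
  · refine (e2 z).unique ?_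
    simp only [h2, smul_zero]
    exact hasSum_zero
  · refine congrFun (e1.coeff_unique (b := 0) fun z => ?_) n
    simp only [h1, Pi.zero_apply, smul_zero]
    exact hasSum_zero
  · refine congrFun (e2.coeff_unique (b := 0) fun z => ?_) n
    simp only [h1, Pi.zero_apply, smul_zero]
    exact hasSum_zero

lemma isCNUContraction_iff (h : IsUnitaryRealization A B C D S) :
    IsCNUContraction A ↔ ∀ x, (∀ z : 𝔻, stateEval A B C z x = 0) → x = 0 := by
  rw [DBR.isCNUContraction_iff]
  simp only [← h.norm_pow_eq_iff_stateEval, and_imp]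
  exact and_iff_right h.norm_le_one

end IsUnitaryRealization

section Defect

variable {X : Type*} [NormedAddCommGroup X] [InnerProductSpace ℂ X] [CompleteSpace X]

lemma blockOp_diag_nonneg {P Q : X →L[ℂ] X} (hP : 0 ≤ P) (hQ : 0 ≤ Q) :
    0 ≤ blockOp P 0 0 Q := by
  rw [ContinuousLinearMap.nonneg_iff_isPositive, ContinuousLinearMap.isPositive_def'] at *
  refine ⟨?_, fun x => ?_⟩
  · rw [isSelfAdjoint_iff', adjoint_blockOp, hP.1.adjoint_eq, hQ.1.adjoint_eq, map_zero]
  · rw [reApplyInnerSelf_apply, inner_eq_add, map_add]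
    simpa [reApplyInnerSelf_apply] using add_nonneg (hP.2 x.fst) (hQ.2 x.snd)

lemma one_sub_adjoint_mul_self_nonneg {T : X →L[ℂ] X} (hT : ‖T‖ ≤ 1) : 0 ≤ 1 - adjoint T * T := by
  rw [ContinuousLinearMap.nonneg_iff_isPositive, ContinuousLinearMap.isPositive_def']
  refine ⟨(IsSelfAdjoint.one _).sub (IsSelfAdjoint.star_mul_self T), fun x => ?_⟩
  have h1 : ‖T x‖ ≤ ‖x‖ := by simpa using T.le_of_opNorm_le hT x
  have h2 : (1 - adjoint T * T).reApplyInnerSelf x = ‖x‖ ^ 2 - ‖T x‖ ^ 2 := by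
    rw [reApplyInnerSelf_apply, sub_apply, one_apply_eq_self, mul_apply_eq_comp, inner_sub_left,
      adjoint_inner_left, map_sub, inner_self_eq_norm_sq, inner_self_eq_norm_sq]
  rw [h2, sub_nonneg]
  gcongr

/-- An operator that commutes with the square of a positive operator commutes with the positive
operator. -/
lemma commute_of_commute_mul_self {P M : X →L[ℂ] X} (hP : 0 ≤ P) (h : Commute (P * P) M) :
    Commute P M := by
  have h1 : Commute (CFC.sqrt (P * P)) M := h.cfcₙ_nnreal NNReal.sqrt
  rwa [CFC.sqrt_mul_self P hP] at h1

/-- The defect operators `P = (1 - T* T)^(1/2)` and `Q = (1 - T T*)^(1/2)` of a contraction, with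
the intertwining relation `T P = Q T`. -/
lemma exists_defect {T : X →L[ℂ] X} (hT : ‖T‖ ≤ 1) : ∃ P Q : X →L[ℂ] X,
    adjoint P = P ∧ adjoint Q = Q ∧ (∀ x, P (P x) = x - adjoint T (T x)) ∧
    (∀ x, Q (Q x) = x - T (adjoint T x)) ∧ ∀ x, T (P x) = Q (T x) := by
  have hT' : ‖adjoint T‖ ≤ 1 := by rwa [LinearIsometryEquiv.norm_map]
  have h1 := one_sub_adjoint_mul_self_nonneg hT
  have h2 := one_sub_adjoint_mul_self_nonneg hT'
  rw [adjoint_adjoint] at h2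
  set P := CFC.sqrt (1 - adjoint T * T) with hP
  set Q := CFC.sqrt (1 - T * adjoint T) with hQ
  have hP0 : 0 ≤ P := CFC.sqrt_nonneg _
  have hQ0 : 0 ≤ Q := CFC.sqrt_nonneg _
  have hPP : ∀ x, P (P x) = x - adjoint T (T x) := fun x =>
    congrArg (fun R => R x) (CFC.sqrt_mul_sqrt_self _ h1)
  have hQQ : ∀ x, Q (Q x) = x - T (adjoint T x) := fun x =>
    congrArg (fun R => R x) (CFC.sqrt_mul_sqrt_self _ h2)
  refine ⟨P, Q, (IsSelfAdjoint.of_nonneg hP0).adjoint_eq, (IsSelfAdjoint.of_nonneg hQ0).adjoint_eq,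
    hPP, hQQ, fun x => ?_⟩
  -- `[0, 0; T, 0]` commutes with `[1 - T* T, 0; 0, 1 - T T*]`, hence with its square root
  have hc : Commute (blockOp P 0 0 Q * blockOp P 0 0 Q) (blockOp 0 0 T 0) := by
    refine ContinuousLinearMap.ext fun p => withLp_ext ?_ ?_
    · simp
    · simp [hPP, hQQ]
  have h3 := (commute_of_commute_mul_self (blockOp_diag_nonneg hP0 hQ0) hc).eq
  have h4 := congrArg (fun R => (R (WithLp.toLp 2 (x, 0))).snd) h3
  simpa using h4.symm

/-- Every contraction is the state operator of a unitary colligation, with Halmos' operator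
`[T, Q; P, -T*]` as the block matrix. -/
lemma exists_isUnitaryRealization {T : X →L[ℂ] X} (hT : ‖T‖ ≤ 1) :
    ∃ (B C D : X →L[ℂ] X) (S : ℂ → X →L[ℂ] X), IsUnitaryRealization T B C D S := by
  obtain ⟨P, Q, hP, hQ, hPP, hQQ, hPQ⟩ := exists_defect hT
  have hPQ' : ∀ x, adjoint T (Q x) = P (adjoint T x) := fun x => by
    refine ext_inner_right ℂ fun y => ?_
    rw [adjoint_inner_left, ← hQ, adjoint_inner_left, ← hPQ, ← adjoint_inner_left,
      ← adjoint_inner_left, hP]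
  refine ⟨Q, P, -adjoint T, fun z => -adjoint T + z • (P ∘L res T z ∘L Q), ?_, fun z => rfl⟩
  rw [isUnitaryOp_blockOp_iff, map_neg, adjoint_adjoint, hP, hQ]
  simp [hPP, hQQ, hPQ, hPQ']

end Defect

section Model

/-- Two structures of a reproducing kernel Hilbert space on the same functions with the same norm
are isometrically isomorphic by the identity. -/
lemma exists_linearIsometryEquiv_of_coe_eq {Ω V H₁ H₂ : Type*} [NormedAddCommGroup V]
    [InnerProductSpace ℂ V] [NormedAddCommGroup H₁] [InnerProductSpace ℂ H₁] [RKHS ℂ H₁ Ω V]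
    [NormedAddCommGroup H₂] [InnerProductSpace ℂ H₂] [RKHS ℂ H₂ Ω V] (e : H₁ ≃ H₂)
    (hcoe : ∀ x, (⇑(e x) : Ω → V) = ⇑x) (hnorm : ∀ x, ‖e x‖ = ‖x‖) :
    ∃ L : H₁ ≃ₗᵢ[ℂ] H₂, ∀ x, L x = e x := by
  let l : H₁ ≃ₗ[ℂ] H₂ :=
    { e with
      map_add' := fun x y => RKHS.ext fun ω => by
        change e (x + y) ω = (e x + e y) ω
        rw [RKHS.coe_add, hcoe, hcoe, hcoe, RKHS.coe_add]
      map_smul' := fun c x => RKHS.ext fun ω => by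
        change e (c • x) ω = (c • e x) ω
        rw [RKHS.coe_smul, hcoe, hcoe, RKHS.coe_smul] }
  exact ⟨⟨l, hnorm⟩, fun x => rfl⟩

variable {U : Type u} [NormedAddCommGroup U] [InnerProductSpace ℂ U] [CompleteSpace U]
  {Y : Type v} [NormedAddCommGroup Y] [InnerProductSpace ℂ Y] [CompleteSpace Y]
  {S : ℂ → U →L[ℂ] Y}

/-- `R̂₀` is completely non-unitary, whichever Hilbert space carries the norm of `D(S)`. -/
lemma IsSchur.isCNUContraction_of_equiv (hS : IsSchur S) {H : Type*} [NormedAddCommGroup H]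
    [InnerProductSpace ℂ H] [CompleteSpace H] [RKHS ℂ H 𝔻 (WithLp 2 (Y × U))] (e : H ≃ DSpace S)
    (hcoe : ∀ x : H, ⇑x = (e x).toFun)
    (hnorm : ∀ x, Tendsto (dSeq S (fun z => ((e x).toFun z).fst) fun z => ((e x).toFun z).snd)
      atTop (𝓝 (‖x‖ ^ 2)))
    {R : H →L[ℂ] H} (hR : ∀ x, (e (R x)).toFun = hatR S (e x).toFun) : IsCNUContraction R := by
  obtain ⟨_, _, _, _, hD, -, A, B, C, hA, hA', -, hC, hB, h⟩ := hS.exists_canonicalModel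
  obtain ⟨L, hL⟩ := exists_linearIsometryEquiv_of_coe_eq (Ω := 𝔻) (V := WithLp 2 (Y × U)) e
    (fun x => by rw [hD.coe_eq', hcoe]) fun x => by
      have := tendsto_nhds_unique (hD.tendsto_norm_sq (e x)) (hnorm x)
      exact (sq_eq_sq₀ (norm_nonneg _) (norm_nonneg _)).1 this
  have hcnu : IsCNUContraction A := h.isCNUContraction_iff.2 fun F hF => by
    refine RKHS.ext fun z => ?_
    rw [hD.coe_eq', RKHS.coe_zero, Pi.zero_apply, ← hF z]
    refine withLp_ext ?_ ?_
    · rw [stateEval_fst, apply_res_eq_fst hD h.norm_le_one hA hC]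
    · rw [stateEval_snd, apply_res_eq_snd hD h.dual.norm_le_one hA' hB]
  refine hcnu.of_intertwining L fun x => DSpace.ext ?_
  rw [hL, hL, hR, hA]

theorem IsModelledBy.isCNUContraction (hS : IsSchur S) {X : Type*} [NormedAddCommGroup X]
    [InnerProductSpace ℂ X] [CompleteSpace X] {T : X →L[ℂ] X} (h : IsModelledBy T S) :
    IsCNUContraction T := by
  obtain ⟨_, _, _, _, hD, R, hR, W, hW⟩ := h
  exact (hS.isCNUContraction_of_equiv (Equiv.refl _) hD.coe_eq' hD.tendsto_norm_sq
    hR).of_intertwining W hW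

/-- A completely non-unitary state operator is modelled by `R̂₀` on the space `D(S)` of the transfer
function: the state `x` corresponds to the pair `z ↦ stateEval A B C z x`. -/
theorem IsUnitaryRealization.isModelledBy {X : Type*} [NormedAddCommGroup X]
    [InnerProductSpace ℂ X] [CompleteSpace X] {A : X →L[ℂ] X} {B : U →L[ℂ] X} {C : X →L[ℂ] Y}
    {D : U →L[ℂ] Y} (h : IsUnitaryRealization A B C D S) (hA : IsCNUContraction A) :
    IsModelledBy A S := by
  obtain ⟨i₁, i₂, i₃, i₄, hD, hK, R, -, -, hR, -⟩ := h.isSchur.exists_canonicalModel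
  obtain ⟨W, hW⟩ := exists_linearIsometryEquiv_of_gram
    (e₁ := fun z : 𝔻 => adjoint (stateEval A B C z)) (e₂ := fun z => RKHS.kerFun (DSpace S) z)
    (fun x hx => h.isCNUContraction_iff.1 hA x fun z => ext_inner_left ℂ fun v => by
      rw [← adjoint_inner_left, hx, inner_zero_right])
    kerFun_total fun z w v v' => by
      rw [← RKHS.kernel_inner, hK, ← h.stateEval_comp_adjoint, adjoint_inner_right, comp_apply]
  have hWx : ∀ x, (W x).toFun = fun z : 𝔻 => stateEval A B C z x := fun x => funext fun z => by
    refine ext_inner_left ℂ fun v => ?_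
    rw [← hD.coe_eq', ← RKHS.kerFun_inner, ← hW, W.inner_map_map, adjoint_inner_left]
  refine ⟨i₁, i₂, i₃, i₄, hD, R, hR, W, fun x => DSpace.ext ?_⟩
  rw [hR, hWx, hWx, h.hatR_stateEval]

end Model

end DBR

end

theorem theorem2p2 {U : Type u} [NormedAddCommGroup U] [InnerProductSpace ℂ U] [CompleteSpace U]
    {Y : Type v} [NormedAddCommGroup Y] [InnerProductSpace ℂ Y] [CompleteSpace Y]
    (S : ℂ → U →L[ℂ] Y) (hS : DBR.IsSchur S) :
    -- the space `D(S)` is a reproducing kernel Hilbert space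
    (∃ (_ : NormedAddCommGroup (DBR.DSpace S)) (_ : InnerProductSpace ℂ (DBR.DSpace S))
      (_ : CompleteSpace (DBR.DSpace S)) (_ : RKHS ℂ (DBR.DSpace S) 𝔻 (WithLp 2 (Y × U))),
      DBR.IsDStructure S ∧
      RKHS.kernel (DBR.DSpace S) = DBR.kHat S ∧
      ∃ (A : DBR.DSpace S →L[ℂ] DBR.DSpace S) (B : U →L[ℂ] DBR.DSpace S)
        (C : DBR.DSpace S →L[ℂ] Y),
        -- the operator `R̂₀`, its adjoint and the norm identities
        (∀ F, (A F).toFun = DBR.hatR S F.toFun) ∧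
        (∀ F, (adjoint A F).toFun = DBR.hatRAdj S F.toFun) ∧
        (∀ F, ‖A F‖ ^ 2 = ‖F‖ ^ 2 - ‖(F.toFun 0).fst‖ ^ 2) ∧
        (∀ F, ‖adjoint A F‖ ^ 2 = ‖F‖ ^ 2 - ‖(F.toFun 0).snd‖ ^ 2) ∧
        -- the colligation and its characteristic function
        (∀ x, (B x).toFun = DBR.hatB S x) ∧
        (∀ F, C F = (F.toFun 0).fst) ∧
        DBR.IsUnitaryOp (DBR.blockOp A B C (S 0)) ∧
        (∀ z : 𝔻, IsUnit (1 - (z : ℂ) • A) ∧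
          S z = S 0 + (z : ℂ) • (C ∘L Ring.inverse (1 - (z : ℂ) • A) ∘L B))) ∧
    -- the operators modelled by `R̂₀`
    (∀ (X : Type w) [NormedAddCommGroup X] [InnerProductSpace ℂ X] [CompleteSpace X]
      (T : X →L[ℂ] X),
      ((∃ (U' Y' : Type w) (_ : NormedAddCommGroup U') (_ : InnerProductSpace ℂ U')
        (_ : CompleteSpace U') (_ : NormedAddCommGroup Y') (_ : InnerProductSpace ℂ Y')
        (_ : CompleteSpace Y') (S' : ℂ → U' →L[ℂ] Y'),
        DBR.IsSchur S' ∧ DBR.IsModelledBy T S') ↔ DBR.IsCNUContraction T) ∧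
      -- separable operators are modelled with separable coefficient spaces
      (TopologicalSpace.SeparableSpace X → DBR.IsCNUContraction T →
        ∃ (U' Y' : Type w) (_ : NormedAddCommGroup U') (_ : InnerProductSpace ℂ U')
        (_ : CompleteSpace U') (_ : NormedAddCommGroup Y') (_ : InnerProductSpace ℂ Y')
        (_ : CompleteSpace Y') (S' : ℂ → U' →L[ℂ] Y'),
        TopologicalSpace.SeparableSpace U' ∧ TopologicalSpace.SeparableSpace Y' ∧
        DBR.IsSchur S' ∧ DBR.IsModelledBy T S')) := by
  refine ⟨?_, fun X _ _ _ T => ⟨⟨?_, fun hT => ?_⟩, fun hX hT => ?_⟩⟩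
  · obtain ⟨i₁, i₂, i₃, i₄, hD, hK, A, B, C, hA, hA', hB, hC, hB', h⟩ := hS.exists_canonicalModel
    refine ⟨i₁, i₂, i₃, i₄, hD, hK, A, B, C, hA, hA', fun F => ?_, fun F => ?_, hB, hC, h.unitary,
      fun z => ⟨DBR.isUnit_one_sub_smul h.norm_le_one z, h.transfer z⟩⟩
    · rw [← hC, ← h.norm_sq_add F, add_sub_cancel_right]
    · rw [← hB', ← h.dual.norm_sq_add F, add_sub_cancel_right]
  · rintro ⟨U', Y', _, _, _, _, _, _, S', hS', h⟩
    exact h.isCNUContraction hS'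
  · obtain ⟨B, C, D, S', h⟩ := DBR.exists_isUnitaryRealization hT.1
    exact ⟨X, X, _, _, inferInstance, _, _, inferInstance, S', h.isSchur, h.isModelledBy hT⟩
  · obtain ⟨B, C, D, S', h⟩ := DBR.exists_isUnitaryRealization hT.1
    exact ⟨X, X, _, _, inferInstance, _, _, inferInstance, S', hX, hX, h.isSchur,
      h.isModelledBy hT⟩
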